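/- Consider an OFDM system with $N\ge 1$ subcarriers, $N_t$ transmit and $N_r$ receive antennas, where $\min(N_r,N_t)=1$ (SIMO/MISO), and put $n=\max(N_r,N_t)$. The channel has length $L$, a power delay profile $\sigma_0,\dots,\sigma_{L-1}\in\mathbb R$ with $\sum_{p}\sigma_p^2=1$, and random $N_r\times N_t$ tap matrices $\mathbf H[0],\dots,\mathbf H[L-1]$ all of whose entries (over all taps and positions) are independent $\mathcal{CN}(0,1)$ variables. For $0\le k<N$ let $$\mathbf H_k=\sum_{p=0}^{L-1}\sigma_p\,\mathbf H[p]\,e^{-2\pi \mathrm{i}kp/N},\qquad \rho_d=\sum_{p=0}^{L-1}\sigma_p^2\,e^{-2\pi \mathrm{i}dp/N},$$ and, for SNR $\gamma>0$, $$\mathcal I_{\rm ofdm}=\frac1N\sum_{k=0}^{N-1}\log_2\det\Bigl(\mathbf I_{N_r}+\frac{\gamma}{N_t}\mathbf H_k\mathbf H_k^\dagger\Bigr).$$ Then $\rho_{k-\ell}$ is the correlation coefficient of the subcarrier channels, $E[(\mathbf H_k)_{i,j}\overline{(\mathbf H_\ell)_{i',j'}}]=\rho_{k-\ell}\,\delta_{ii'}\delta_{jj'}$;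 the random variable $\mathcal I_{\rm ofdm}$ is square integrable for every $\gamma>0$; and $$\lim_{\gamma\to\infty}\operatorname{Var}(\mathcal I_{\rm ofdm})=(\log_2 e)^2\left(\frac{2}{N^2}\sum_{d=1}^{N-1}(N-d)\,\tilde\varphi(\rho_d)+\frac{\psi'(n)}{N}\right).$$ Here $\psi'$ is the derivative of the digamma function $\psi=\Gamma'/\Gamma$, $\tilde\varphi(\rho_d)=0$ if $|\rho_d|=0$, $\tilde\varphi(\rho_d)=\psi'(n)$ if $|\rho_d|=1$, and, if $0<|\rho_d|<1$, $$\tilde\varphi(\rho_d)=\mathrm{Li}_2(1-|\rho_d|^2)-H(n-1)^2+2\sum_{b=1}^{n-1}\frac{H(b-1)}{b}+\sum_{b=1}^{n-1}\frac1b\left(\Bigl(\tfrac{|\rho_d|^2-1}{|\rho_d|^2}\Bigr)^{b}\ln(1-|\rho_d|^2)-\sum_{t=0}^{b-2}\frac{\bigl(\frac{|\rho_d|^2-1}{|\rho_d|^2}\bigr)^{t+1}}{b-t-1}\right),$$ where $H(z)=\sum_{\ell=1}^{z}1/\ell$ (with $H(0)=0$) is the harmonic number and $\mathrm{Li}_2$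 is the dilogarithm in the Abramowitz–Stegun convention $\mathrm{Li}_2(x)=-\int_1^x\frac{\ln t}{t-1}\,dt$ (so that $\mathrm{Li}_2(1-y)=\sum_{k\ge1}y^k/k^2$ for $0\le y\le1$). -/

import Mathlib

open MeasureTheory ProbabilityTheory Filter Topology
open scoped Matrix

noncomputable section

namespace OFDM

/-- The law `CN(0,1)`: independent real and imaginary parts, each real Gaussian with mean `0` and
variance `1/2`. -/
def complexGaussian : Measure ℂ :=
  ((gaussianReal 0 (1 / 2)).prod (gaussianReal 0 (1 / 2))).map
    (fun p : ℝ × ℝ => (p.1 : ℂ) + (p.2 : ℂ) * Complex.I)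

/-- The channel matrix `H_k = ∑_p σ_p H[p] exp(-j 2π k p / N)` of subcarrier `k`, for one
realization `H[0], …, H[L-1]` of the channel impulse response. -/
def subcarrierMatrix {L Nr Nt : ℕ} (N : ℕ) (σ : Fin L → ℝ)
    (H : Fin L → Matrix (Fin Nr) (Fin Nt) ℂ) (k : ℕ) : Matrix (Fin Nr) (Fin Nt) ℂ :=
  ∑ p : Fin L,
    ((σ p : ℂ) * Complex.exp (-(2 * Real.pi * (k : ℂ) / (N : ℂ) * (p : ℂ)) * Complex.I)) • H p

/-- The frequency correlation coefficient `ρ_d = ∑_p σ_p² exp(-j 2π d p / N)`. -/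
def freqCorr {L : ℕ} (N : ℕ) (σ : Fin L → ℝ) (d : ℤ) : ℂ :=
  ∑ p : Fin L,
    ((σ p : ℂ) ^ 2 * Complex.exp (-(2 * Real.pi * (d : ℂ) / (N : ℂ) * (p : ℂ)) * Complex.I))

/-- The mutual information `log₂ det (I + (γ / N_t) A Aᴴ)` of a flat channel with matrix `A`.
The determinant is a positive real number, read off as the real part of a complex one. -/
def flatMI {Nr Nt : ℕ} (γ : ℝ) (A : Matrix (Fin Nr) (Fin Nt) ℂ) : ℝ :=
  Real.logb 2 (Matrix.det (1 + ((γ / (Nt : ℝ) : ℝ) : ℂ) • (A * Aᴴ))).re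

/-- The mutual information of the OFDM system: the average over the `N` subcarriers. -/
def ofdmMI {L Nr Nt : ℕ} (N : ℕ) (σ : Fin L → ℝ) (γ : ℝ)
    (H : Fin L → Matrix (Fin Nr) (Fin Nt) ℂ) : ℝ :=
  (1 / (N : ℝ)) * ∑ k ∈ Finset.range N, flatMI γ (subcarrierMatrix N σ H k)

/-- The polygamma function `ψ'`, the derivative of the digamma function, at a real point (where
its value is real). -/
def trigamma (x : ℝ) : ℝ := (deriv Complex.digamma (x : ℂ)).re

/-- The dilogarithm in the convention of Abramowitz and Stegun,
`Li₂(x) = -∫_1^x ln t / (t - 1) dt`; thus `Li₂(1 - y) = ∑_{k ≥ 1} y^k / k²` for `0 ≤ y ≤ 1`. -/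
def dilog (x : ℝ) : ℝ := -∫ t in (1 : ℝ)..x, Real.log t / (t - 1)

/-- The function `φ̃`, as a function of `n` and of `r = |ρ_d| ∈ [0, 1]`. -/
def phiTilde (n : ℕ) (r : ℝ) : ℝ :=
  if r = 0 then 0
  else if r = 1 then trigamma n
  else
    dilog (1 - r ^ 2) - ((harmonic (n - 1) : ℚ) : ℝ) ^ 2
      + 2 * ∑ b ∈ Finset.Icc 1 (n - 1), ((harmonic (b - 1) : ℚ) : ℝ) / (b : ℝ)
      + ∑ b ∈ Finset.Icc 1 (n - 1), (1 / (b : ℝ)) *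
          (((r ^ 2 - 1) / r ^ 2) ^ b * Real.log (1 - r ^ 2)
            - ∑ t ∈ Finset.range (b - 1),
                ((r ^ 2 - 1) / r ^ 2) ^ (t + 1) / ((b : ℝ) - (t : ℝ) - 1))

end OFDM

end

/-! Since `min Nr Nt = 1`, the determinant on subcarrier `k` is `1 + (γ / Nt) X_k`, where `X_k` is
the sum of the squared moduli of the `n` entries of `H_k` (`flatMI_eq`). With `c = γ / Nt`, `log (1
+ c X) = log c + log (X + 1 / c)`; the constant drops out of the variance, and dominated convergence
replaces `X + 1 / c` by `X` (`tendsto_variance_mean_logb`). The limit is a double sum of covariances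
of `log X_k` and `log X_l`, which depend only on `|ρ_{k-l}|`; grouping by difference gives the
weights `N - d`, and the diagonal gives `ψ'(n)`.

Each covariance comes from a Laplace transform. The Frullani formula `log x = ∫ (e^{-a} - e^{-xa}) /
a da` turns it into a double integral of the joint transform minus the product of the marginals,
divided by `a b` (`covariance_log_of_laplace`). Writing exponentials of squared moduli as Gaussian
mixtures of characters shows that the joint transform is `((1 + a)(1 + b) - |ρ|² a b)⁻ⁿ`
(`integral_exp_neg_mul_pair`).

With `y = |ρ|² < 1` and `n = m + 1`, expanding in `y` and using Euler's beta integral gives `∑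
y^{k+1} B(k+1, m+1) / (k+1)` (`hasSum_logCov`). For `m = 0` this is the dilogarithm, and a partial
fraction recurrence in `m` gives the closed form (`logCov_closed_form`). At `y = 1` the same
integral is the variance of the logarithm of a gamma variable, hence `ψ'(n)` (`trigamma_eq_logCov`).
-/

namespace OFDM

/-! ### A Frullani integral for the logarithm -/

/-- Dominates the Frullani integrand at both ends: the factor `|v - u|` cancels `1 / a` at zero, and
the exponential gives decay at infinity. -/
lemma abs_exp_neg_sub_exp_neg_le (u v : ℝ) :
    |Real.exp (-u) - Real.exp (-v)| ≤ |v - u| * Real.exp (-min u v) := by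
  wlog h : u ≤ v generalizing u v
  · rw [abs_sub_comm, abs_sub_comm v u, min_comm]
    exact this v u (le_of_not_ge h)
  have h1 : Real.exp (-v) ≤ Real.exp (-u) := Real.exp_le_exp.2 (by linarith)
  rw [abs_of_nonneg (by linarith), abs_of_nonneg (by linarith), min_eq_left h]
  have h2 : Real.exp (-v) = Real.exp (-u) * Real.exp (-(v - u)) := by
    rw [← Real.exp_add]; ring_nf
  rw [h2]
  nlinarith [Real.add_one_le_exp (-(v - u)), Real.exp_pos (-u)]

lemma integrableOn_frullani {x : ℝ} (hx : 0 < x) :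
    IntegrableOn (fun a : ℝ => a⁻¹ * (Real.exp (-a) - Real.exp (-(x * a)))) (Set.Ioi 0) := by
  have hm : 0 < min 1 x := lt_min one_pos hx
  have hb : IntegrableOn (fun a : ℝ => |x - 1| * Real.exp (-min 1 x * a)) (Set.Ioi 0) :=
    (integrableOn_exp_mul_Ioi (by linarith) 0).const_mul _
  refine Integrable.mono' hb ?_ ?_
  · exact (by fun_prop : Measurable fun a : ℝ =>
      a⁻¹ * (Real.exp (-a) - Real.exp (-(x * a)))).aestronglyMeasurable
  · refine (ae_restrict_iff' measurableSet_Ioi).2 (ae_of_all _ fun a ha => ?_)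
    have ha : 0 < a := ha
    have h := abs_exp_neg_sub_exp_neg_le a (x * a)
    have e1 : |x * a - a| = a * |x - 1| := by
      rw [show x * a - a = a * (x - 1) by ring, abs_mul, abs_of_pos ha]
    have e2 : min a (x * a) = min 1 x * a := by
      rw [min_mul_of_nonneg _ _ ha.le, one_mul]
    rw [e1, e2] at h
    rw [Real.norm_eq_abs, abs_mul, abs_inv, abs_of_pos ha, inv_mul_le_iff₀ ha]
    calc _ ≤ _ := h
      _ = _ := by ring_nf

lemma integral_frullani {x : ℝ} (hx : 0 < x) :
    ∫ a in Set.Ioi (0 : ℝ), a⁻¹ * (Real.exp (-a) - Real.exp (-(x * a))) = Real.log x := by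
  have h := Frullani.integral_Ioi_eq (f := fun t : ℝ => Real.exp (-t)) (a := 1) (b := x)
    (L := 1) (R := 0)
    ((Continuous.continuousOn (by fun_prop)).locallyIntegrableOn measurableSet_Ioi) one_pos hx
    (by
      have : Tendsto (fun t : ℝ => Real.exp (-t)) (𝓝 0) (𝓝 (Real.exp (-0))) :=
        Continuous.tendsto (by fun_prop) 0
      simpa using this.mono_left nhdsWithin_le_nhds)
    (Real.tendsto_exp_neg_atTop_nhds_zero)
    (by simpa using integrableOn_frullani hx)
  simpa using h

/-- The integrand has constant sign, so taking absolute values loses nothing. Integrability of the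
logarithm is then exactly what Fubini needs. -/
lemma integral_abs_frullani {x : ℝ} (hx : 0 < x) :
    ∫ a in Set.Ioi (0 : ℝ), |a⁻¹ * (Real.exp (-a) - Real.exp (-(x * a)))| = |Real.log x| := by
  rcases le_total 1 x with h | h
  · rw [abs_of_nonneg (Real.log_nonneg h), ← integral_frullani hx]
    refine setIntegral_congr_fun measurableSet_Ioi fun a ha => abs_of_nonneg ?_
    have ha : 0 < a := ha
    have : Real.exp (-(x * a)) ≤ Real.exp (-a) := Real.exp_le_exp.2 (by nlinarith)
    have := inv_pos.2 ha
    exact mul_nonneg this.le (by linarith)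
  · rw [abs_of_nonpos (Real.log_nonpos hx.le h), ← integral_frullani hx, ← integral_neg]
    refine setIntegral_congr_fun measurableSet_Ioi fun a ha => abs_of_nonpos ?_
    have ha : 0 < a := ha
    have : Real.exp (-a) ≤ Real.exp (-(x * a)) := Real.exp_le_exp.2 (by nlinarith)
    have := inv_pos.2 ha
    exact mul_nonpos_of_nonneg_of_nonpos this.le (by linarith)

/-! ### An Euler beta integral -/

lemma hasDerivAt_pow_div_one_add_pow (k j : ℕ) {a : ℝ} (ha : 0 ≤ a) :
    HasDerivAt (fun a : ℝ => a ^ (k + 1) / (1 + a) ^ (j + 1))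
      ((k + 1) * (a ^ k / (1 + a) ^ (j + 1)) - (j + 1) * (a ^ (k + 1) / (1 + a) ^ (j + 2))) a := by
  have h1 : (1 + a) ≠ 0 := by linarith
  have h2 : HasDerivAt (fun a : ℝ => (1 + a) ^ (j + 1)) ((j + 1) * (1 + a) ^ j) a := by
    simpa using ((hasDerivAt_id a).const_add 1).fun_pow (j + 1)
  have h3 : HasDerivAt (fun a : ℝ => a ^ (k + 1)) ((k + 1) * a ^ k) a := by
    simpa using hasDerivAt_pow (k + 1) a
  convert! h3.div h2 (pow_ne_zero _ h1) using 1
  field_simp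
  ring

lemma hasDerivAt_neg_one_div_one_add_pow (m : ℕ) {x : ℝ} (hx : 0 ≤ x) :
    HasDerivAt (fun a : ℝ => -(a ^ 0 / (1 + a) ^ (m + 1)))
      ((m + 1) * (x ^ 0 / (1 + x) ^ (m + 2))) x := by
  have h1 : (1 + x) ≠ 0 := by linarith
  have h2 : HasDerivAt (fun a : ℝ => (1 + a) ^ (m + 1)) ((m + 1) * (1 + x) ^ m) x := by
    simpa using ((hasDerivAt_id x).const_add 1).fun_pow (m + 1)
  convert! ((h2.inv (pow_ne_zero _ h1)).neg) using 1
  · ext a; simp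
  · field_simp
    ring

lemma tendsto_pow_div_one_add_pow {k j : ℕ} (h : k < j) :
    Tendsto (fun a : ℝ => a ^ k / (1 + a) ^ j) atTop (𝓝 0) := by
  have h0 : Tendsto (fun a : ℝ => (1 + a)⁻¹) atTop (𝓝 0) :=
    tendsto_inv_atTop_zero.comp (tendsto_atTop_add_const_left _ _ tendsto_id)
  refine squeeze_zero' ?_ ?_ h0
  · filter_upwards [eventually_ge_atTop 0] with a ha
    positivity
  · filter_upwards [eventually_ge_atTop 0] with a ha
    obtain ⟨i, rfl⟩ := Nat.exists_eq_add_of_lt h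
    rw [inv_eq_one_div, div_le_div_iff₀ (by positivity) (by positivity), one_mul]
    calc a ^ k * (1 + a) ≤ (1 + a) ^ k * (1 + a) := by gcongr; linarith
      _ = (1 + a) ^ (k + 1) := by ring
      _ ≤ _ := pow_le_pow_right₀ (by linarith) (by omega)

lemma integrableOn_beta_kernel (k m : ℕ) :
    IntegrableOn (fun a : ℝ => a ^ k / (1 + a) ^ (m + k + 2)) (Set.Ioi 0) := by
  induction k with
  | zero =>
    have hd := fun x (hx : x ∈ Set.Ici (0 : ℝ)) => hasDerivAt_neg_one_div_one_add_pow m hx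
    have h := integrableOn_Ioi_deriv_of_nonneg' hd
      (fun x hx => by have hx : (0 : ℝ) < x := hx; positivity)
      (tendsto_pow_div_one_add_pow (by omega : 0 < m + 1)).neg
    have h' := h.const_mul ((m : ℝ) + 1)⁻¹
    refine h'.congr (ae_of_all _ fun x => ?_)
    have : (m : ℝ) + 1 ≠ 0 := by positivity
    simp only [add_zero]
    field_simp
  | succ k ih =>
    refine Integrable.mono' ih ?_ ?_
    · exact (by fun_prop : Measurable fun a : ℝ =>
        a ^ (k + 1) / (1 + a) ^ (m + (k + 1) + 2)).aestronglyMeasurable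
    · refine (ae_restrict_iff' measurableSet_Ioi).2 (ae_of_all _ fun a ha => ?_)
      have ha : 0 < a := ha
      rw [Real.norm_of_nonneg (by positivity), div_le_div_iff₀ (by positivity) (by positivity)]
      have : a ^ (k + 1) * (1 + a) ^ (m + k + 2) ≤ a ^ k * ((1 + a) * (1 + a) ^ (m + k + 2)) := by
        rw [pow_succ, mul_assoc]; gcongr; linarith
      calc _ ≤ _ := this
        _ = _ := by ring

/-- Euler's `B(k+1, m+1)` in the variable `a / (1 + a)`. Integrating the derivative of `a^(k+1) /
(1+a)^(m+k+2)`, whose boundary values vanish, lowers `k` by one. -/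
lemma integral_beta_kernel (k m : ℕ) :
    ∫ a in Set.Ioi (0 : ℝ), a ^ k / (1 + a) ^ (m + k + 2) =
      (k.factorial * m.factorial : ℝ) / ((k + m + 1).factorial : ℝ) := by
  induction k with
  | zero =>
    have hd := fun x (hx : x ∈ Set.Ici (0 : ℝ)) => hasDerivAt_neg_one_div_one_add_pow m hx
    have h := integral_Ioi_of_hasDerivAt_of_tendsto' hd
      ((integrableOn_beta_kernel 0 m).const_mul _)
      (tendsto_pow_div_one_add_pow (by omega : 0 < m + 1)).neg
    rw [integral_const_mul] at h
    simp only [add_zero, zero_add, neg_zero, sub_neg_eq_add, Nat.factorial_zero, Nat.cast_one,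
      one_mul, pow_zero, one_pow, div_one] at h ⊢
    have h3 : (m : ℝ) + 1 ≠ 0 := by positivity
    have h4 : (m.factorial : ℝ) ≠ 0 := by positivity
    rw [Nat.factorial_succ]; push_cast
    field_simp
    linarith
  | succ k ih =>
    have hI := (integrableOn_beta_kernel k m)
    have hI' := (integrableOn_beta_kernel (k + 1) m)
    have e : m + k + 1 + 2 = m + (k + 1) + 2 := by ring
    have hd := fun x (hx : x ∈ Set.Ici (0 : ℝ)) => hasDerivAt_pow_div_one_add_pow k (m + k + 1) hx
    simp only [e] at hd
    have h := integral_Ioi_of_hasDerivAt_of_tendsto' hd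
      ((hI.const_mul _).sub (hI'.const_mul _))
      (tendsto_pow_div_one_add_pow (by omega : k + 1 < m + k + 1 + 1))
    erw [integral_sub (hI.const_mul _) (hI'.const_mul _)] at h
    rw [integral_const_mul, integral_const_mul, ih] at h
    rw [zero_pow (by omega), zero_div, sub_zero] at h
    have h5 : ((k + 1 + m + 1).factorial : ℝ) = (k + m + 2) * ((k + m + 1).factorial : ℝ) := by
      rw [show k + 1 + m + 1 = (k + m + 1) + 1 by ring, Nat.factorial_succ]; push_cast; ring
    rw [h5, Nat.factorial_succ]
    have h6 : ((k + m + 1).factorial : ℝ) ≠ 0 := by positivity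
    have h7 : (k : ℝ) + m + 2 ≠ 0 := by positivity
    push_cast at h ⊢
    field_simp at h ⊢
    linarith

/-! ### The covariance integral and its power series -/

/-- The covariance of `log X` and `log Y`, for a pair whose joint Laplace transform is
`((1 + a) (1 + b) - y a b)⁻ⁿ` with `n = m + 1`, as an integral of that transform. -/
noncomputable def logCov (m : ℕ) (y : ℝ) : ℝ :=
  ∫ p : ℝ × ℝ, ((((1 + p.1) * (1 + p.2) - y * (p.1 * p.2)) ^ (m + 1))⁻¹
    - (((1 + p.1) * (1 + p.2)) ^ (m + 1))⁻¹) / (p.1 * p.2)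
    ∂((volume.restrict (Set.Ioi (0 : ℝ))).prod (volume.restrict (Set.Ioi (0 : ℝ))))

/-- The coefficients `k! m! / (k + m + 1)!`, the values of the beta function at integers. -/
noncomputable def betaCoeff (m k : ℕ) : ℝ :=
  (k.factorial * m.factorial : ℝ) / ((k + m + 1).factorial : ℝ)

lemma betaCoeff_pos (m k : ℕ) : 0 < betaCoeff m k := by
  unfold betaCoeff; positivity

lemma betaCoeff_zero_left (k : ℕ) : betaCoeff 0 k = 1 / (k + 1) := by
  unfold betaCoeff
  have : (k.factorial : ℝ) ≠ 0 := by positivity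
  rw [add_zero, Nat.factorial_succ]
  push_cast
  field_simp
  simp

lemma betaCoeff_zero_right (m : ℕ) : betaCoeff m 0 = 1 / (m + 1) := by
  unfold betaCoeff
  have : (m.factorial : ℝ) ≠ 0 := by positivity
  rw [zero_add, Nat.factorial_succ]
  push_cast
  field_simp
  simp

/-- Under the beta integral this is `x^k (1-x)^(m+1) = x^k (1-x)^m - x^(k+1) (1-x)^m`. -/
lemma betaCoeff_succ_left (m k : ℕ) :
    betaCoeff (m + 1) k = betaCoeff m k - betaCoeff m (k + 1) := by
  unfold betaCoeff
  rw [show k + (m + 1) + 1 = k + m + 1 + 1 by ring, show k + 1 + m + 1 = k + m + 1 + 1 by ring,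
    Nat.factorial_succ (k + m + 1), Nat.factorial_succ m, Nat.factorial_succ k]
  have : ((k + m + 1).factorial : ℝ) ≠ 0 := by positivity
  push_cast
  field_simp
  ring

lemma betaCoeff_le_one (m k : ℕ) : betaCoeff m k ≤ 1 := by
  induction m with
  | zero =>
    rw [betaCoeff_zero_left, div_le_one (by positivity)]
    linarith [(Nat.cast_nonneg k : (0 : ℝ) ≤ k)]
  | succ m ih => rw [betaCoeff_succ_left]; linarith [betaCoeff_pos m (k + 1)]

/-- The double integral of the `k`-th term produces a binomial coefficient times a squared beta
value; this collapses the product to a single beta value. -/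
lemma choose_mul_betaCoeff_sq (m k : ℕ) :
    ((k + 1 + m).choose m : ℝ) * betaCoeff m k ^ 2 = betaCoeff m k / (k + 1) := by
  have h := Nat.add_choose_mul_factorial_mul_factorial (k + 1) m
  have h' : (((k + 1 + m).choose m : ℕ) : ℝ) * (k + 1).factorial * m.factorial
      = (k + 1 + m).factorial := by exact_mod_cast h
  rw [Nat.factorial_succ, show k + 1 + m = k + m + 1 by ring] at h'
  unfold betaCoeff
  rw [show k + 1 + m = k + m + 1 by ring]
  have h1 : ((k + m + 1).factorial : ℝ) ≠ 0 := by positivity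
  have h2 : (k.factorial : ℝ) ≠ 0 := by positivity
  have h3 : (m.factorial : ℝ) ≠ 0 := by positivity
  push_cast at h'
  field_simp
  linarith

lemma hasSum_logCov_kernel (m : ℕ) {y a b : ℝ} (hy : 0 ≤ y) (hy1 : y < 1) (ha : 0 < a)
    (hb : 0 < b) :
    HasSum (fun k : ℕ => ((k + 1 + m).choose m : ℝ) * y ^ (k + 1) *
        ((a ^ k / (1 + a) ^ (m + k + 2)) * (b ^ k / (1 + b) ^ (m + k + 2))))
      (((((1 + a) * (1 + b) - y * (a * b)) ^ (m + 1))⁻¹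
        - (((1 + a) * (1 + b)) ^ (m + 1))⁻¹) / (a * b)) := by
  set w := y * (a * b) / ((1 + a) * (1 + b)) with hw
  have hD : 0 < (1 + a) * (1 + b) := by positivity
  have hab : a * b < (1 + a) * (1 + b) := by nlinarith
  have hw0 : 0 ≤ w := by positivity
  have hw1 : w < 1 := by
    rw [hw, div_lt_one hD]; nlinarith [mul_pos ha hb]
  have hs := hasSum_choose_mul_geometric_of_norm_lt_one (r := w) m
    (by rwa [Real.norm_of_nonneg hw0])
  -- With `(1 + a)(1 + b)` factored out, what remains is `(1 - w)^(-(m+1))`. Removing the constant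
  -- term of its series is the subtraction of the product of the marginals.
  rw [← hasSum_nat_add_iff' 1] at hs
  have hs' := hs.mul_left ((((1 + a) * (1 + b)) ^ (m + 1))⁻¹ / (a * b))
  have e1 : (1 + a) * (1 + b) - y * (a * b) = ((1 + a) * (1 + b)) * (1 - w) := by
    rw [hw]; field_simp
  convert! hs' using 1
  · ext k
    have hA : 1 + a ≠ 0 := by positivity
    have hB : 1 + b ≠ 0 := by positivity
    rw [hw]
    generalize 1 + a = A at hA
    generalize 1 + b = B at hB
    simp only [div_pow, mul_pow]
    field_simp
    ring
  · rw [e1, mul_pow, mul_inv]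
    simp
    ring

lemma hasSum_logCov (m : ℕ) {y : ℝ} (hy : 0 ≤ y) (hy1 : y < 1) :
    HasSum (fun k : ℕ => y ^ (k + 1) * (betaCoeff m k / (k + 1))) (logCov m y) := by
  set ν := volume.restrict (Set.Ioi (0 : ℝ)) with hν
  let F : ℕ → ℝ × ℝ → ℝ := fun k p => ((k + 1 + m).choose m : ℝ) * y ^ (k + 1) *
        ((p.1 ^ k / (1 + p.1) ^ (m + k + 2)) * (p.2 ^ k / (1 + p.2) ^ (m + k + 2)))
  have hpos : ∀ᵐ p ∂(ν.prod ν), 0 < p.1 ∧ 0 < p.2 := by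
    rw [hν, Measure.prod_restrict, ae_restrict_iff' (measurableSet_Ioi.prod measurableSet_Ioi)]
    exact ae_of_all _ fun p hp => hp
  have hint : ∀ k, Integrable (F k) (ν.prod ν) := fun k =>
    (Integrable.mul_prod (integrableOn_beta_kernel k m) (integrableOn_beta_kernel k m)).const_mul _
  have hF : ∀ k, ∫ p, F k p ∂(ν.prod ν) = y ^ (k + 1) * (betaCoeff m k / (k + 1)) := by
    intro k
    rw [integral_const_mul, integral_prod_mul (fun a : ℝ => a ^ k / (1 + a) ^ (m + k + 2))
      (fun a : ℝ => a ^ k / (1 + a) ^ (m + k + 2)), integral_beta_kernel,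
      ← choose_mul_betaCoeff_sq, betaCoeff]
    ring
  have hnorm : ∀ k, ∫ p, ‖F k p‖ ∂(ν.prod ν) = y ^ (k + 1) * (betaCoeff m k / (k + 1)) := by
    intro k
    rw [← hF k]
    refine integral_congr_ae ?_
    filter_upwards [hpos] with p hp
    obtain ⟨h1, h2⟩ := hp
    exact Real.norm_of_nonneg (by positivity)
  -- The terms are nonnegative, so the norms have the same integrals; these are bounded by `y ^ k`,
  -- and `y < 1` makes the bound summable.
  have hsum : Summable fun k => ∫ p, ‖F k p‖ ∂(ν.prod ν) := by
    simp_rw [hnorm]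
    refine Summable.of_nonneg_of_le (fun k => ?_) (fun k => ?_)
      (summable_geometric_of_lt_one hy hy1)
    · have := betaCoeff_pos m k
      positivity
    · have h1 := betaCoeff_pos m k
      have h2 : betaCoeff m k / (k + 1) ≤ 1 := by
        rw [div_le_one (by positivity)]
        linarith [betaCoeff_le_one m k, (Nat.cast_nonneg k : (0 : ℝ) ≤ k)]
      calc y ^ (k + 1) * (betaCoeff m k / (k + 1)) ≤ y ^ (k + 1) * 1 := by gcongr
        _ ≤ y ^ k := by rw [mul_one, pow_succ]; nlinarith [pow_nonneg hy k]
  have h := hasSum_integral_of_summable_integral_norm hint hsum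
  simp_rw [hF] at h
  convert! h using 1
  refine integral_congr_ae ?_
  filter_upwards [hpos] with p hp
  exact (hasSum_logCov_kernel m hy hy1 hp.1 hp.2).tsum_eq.symm

lemma logCov_zero (m : ℕ) : logCov m 0 = 0 := by
  simp [logCov]

/-! ### The dilogarithm -/

lemma hasSum_dilog {y : ℝ} (hy : 0 ≤ y) (hy1 : y < 1) :
    HasSum (fun k : ℕ => y ^ (k + 1) * (1 / ((k : ℝ) + 1) ^ 2)) (dilog (1 - y)) := by
  have e : dilog (1 - y) = ∫ s in (0 : ℝ)..y, -Real.log (1 - s) / s := by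
    have h := intervalIntegral.integral_comp_sub_left (a := 0) (b := y)
      (fun t : ℝ => Real.log t / (t - 1)) 1
    rw [dilog, intervalIntegral.integral_symm, neg_neg]
    rw [sub_zero] at h
    rw [← h]
    refine intervalIntegral.integral_congr fun s _ => ?_
    rw [show (1 : ℝ) - s - 1 = -s by ring, div_neg, neg_div]
  rw [e, intervalIntegral.integral_of_le hy]
  let F : ℕ → ℝ → ℝ := fun k s => s ^ k / (k + 1)
  have hint : ∀ k, Integrable (F k) (volume.restrict (Set.Ioc 0 y)) := fun k =>
    ((continuous_pow k).div_const _).integrableOn_Ioc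
  have hF : ∀ k, ∫ s in Set.Ioc 0 y, F k s = y ^ (k + 1) * (1 / ((k : ℝ) + 1) ^ 2) := by
    intro k
    rw [← intervalIntegral.integral_of_le hy, intervalIntegral.integral_div, integral_pow]
    field_simp
    simp
  have hnorm : ∀ k, ∫ s in Set.Ioc 0 y, ‖F k s‖ = y ^ (k + 1) * (1 / ((k : ℝ) + 1) ^ 2) := by
    intro k
    rw [← hF k]
    refine setIntegral_congr_fun measurableSet_Ioc fun s hs => ?_
    have := hs.1.le
    exact Real.norm_of_nonneg (by positivity)
  have hsum : Summable fun k => ∫ s in Set.Ioc 0 y, ‖F k s‖ := by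
    simp_rw [hnorm]
    refine Summable.of_nonneg_of_le (fun k => by positivity) (fun k => ?_)
      (summable_geometric_of_lt_one hy hy1)
    have h2 : 1 / ((k : ℝ) + 1) ^ 2 ≤ 1 := by
      rw [div_le_one (by positivity)]
      nlinarith [(Nat.cast_nonneg k : (0 : ℝ) ≤ k)]
    calc y ^ (k + 1) * (1 / ((k : ℝ) + 1) ^ 2) ≤ y ^ (k + 1) * 1 := by gcongr
      _ ≤ y ^ k := by rw [mul_one, pow_succ]; nlinarith [pow_nonneg hy k]
  have h := hasSum_integral_of_summable_integral_norm hint hsum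
  simp_rw [hF] at h
  convert! h using 1
  refine setIntegral_congr_fun measurableSet_Ioc fun s hs => ?_
  have hs0 : 0 < s := hs.1
  have hs1 : |s| < 1 := by rw [abs_of_pos hs0]; linarith [hs.2]
  have h3 := ((Real.hasSum_pow_div_log_of_abs_lt_one hs1).div_const s).tsum_eq
  rw [← h3]
  refine tsum_congr fun k => ?_
  simp only [F]
  field_simp
  ring

/-! ### The closed form of the covariance -/

lemma summable_pow_mul_betaCoeff (m : ℕ) {y : ℝ} (hy : 0 ≤ y) (hy1 : y < 1) :
    Summable fun k : ℕ => y ^ k * betaCoeff m k :=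
  Summable.of_nonneg_of_le (fun k => mul_nonneg (pow_nonneg hy k) (betaCoeff_pos m k).le)
    (fun k => mul_le_of_le_one_right (pow_nonneg hy k) (betaCoeff_le_one m k))
    (summable_geometric_of_lt_one hy hy1)

/-- The generating function of the numbers `betaCoeff m k`, in closed form. -/
lemma hasSum_pow_mul_betaCoeff (m : ℕ) {y : ℝ} (hy : 0 < y) (hy1 : y < 1) :
    HasSum (fun k : ℕ => y ^ (k + 1) * betaCoeff m k)
      (-(((y - 1) / y) ^ m * Real.log (1 - y))
        + ∑ t ∈ Finset.range m, ((y - 1) / y) ^ t / ((m : ℝ) - t)) := by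
  induction m with
  | zero =>
    have h := Real.hasSum_pow_div_log_of_abs_lt_one (x := y) (by rwa [abs_of_pos hy])
    simpa [betaCoeff_zero_left, div_eq_mul_inv] using h
  | succ m ih =>
    have h0 := (hasSum_nat_add_iff' (f := fun k : ℕ => y ^ k * betaCoeff m k)
      (g := (∑' k : ℕ, y ^ k * betaCoeff m k)) 1).2
      (summable_pow_mul_betaCoeff m hy.le hy1).hasSum
    simp only [Finset.range_one, Finset.sum_singleton, pow_zero, one_mul,
      betaCoeff_zero_right] at h0
    have h1 : y * (∑' k : ℕ, y ^ k * betaCoeff m k) = (-(((y - 1) / y) ^ m * Real.log (1 - y))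
        + ∑ t ∈ Finset.range m, ((y - 1) / y) ^ t / ((m : ℝ) - t)) := by
      rw [← tsum_mul_left, ← ih.tsum_eq]
      exact tsum_congr fun k => by ring
    -- By `betaCoeff_succ_left`, the new series is the old one minus its shift, which is the old one
    -- divided by `y` without its constant term.
    have h2 := ih.sub h0
    have h3 : (∑' k : ℕ, y ^ k * betaCoeff m k) = y⁻¹ *
        (-(((y - 1) / y) ^ m * Real.log (1 - y))
          + ∑ t ∈ Finset.range m, ((y - 1) / y) ^ t / ((m : ℝ) - t)) := by
      rw [← h1]; field_simp
    rw [h3] at h2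
    convert! h2 using 1
    · ext k
      rw [betaCoeff_succ_left]; ring
    · rw [Finset.sum_range_succ']
      have e : ∀ t ∈ Finset.range m, ((y - 1) / y) ^ (t + 1) / (((m + 1 : ℕ) : ℝ) - ((t + 1 : ℕ) : ℝ))
          = ((y - 1) / y) * (((y - 1) / y) ^ t / ((m : ℝ) - t)) := by
        intro t _
        push_cast
        rw [show (m : ℝ) + 1 - (t + 1) = m - t by ring, pow_succ]
        ring
      rw [Finset.sum_congr rfl e, ← Finset.mul_sum]
      generalize ∑ t ∈ Finset.range m, ((y - 1) / y) ^ t / ((m : ℝ) - t) = S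
      rw [pow_succ]
      generalize ((y - 1) / y) ^ m = Q
      push_cast
      have : (m : ℝ) + 1 ≠ 0 := by positivity
      simp only [pow_zero, sub_zero]
      field_simp
      ring

/-- Partial fractions: the denominator `k + 1` survives only on the lower index `m`, so the
increment in `m` is a generating function already summed in `hasSum_pow_mul_betaCoeff`. -/
lemma betaCoeff_succ_div (m k : ℕ) :
    betaCoeff (m + 1) k / (k + 1) = betaCoeff m k / (k + 1) - betaCoeff (m + 1) k / (m + 1) := by
  unfold betaCoeff
  rw [show k + (m + 1) + 1 = k + m + 1 + 1 by ring, Nat.factorial_succ (k + m + 1),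
    Nat.factorial_succ m]
  have : ((k + m + 1).factorial : ℝ) ≠ 0 := by positivity
  push_cast
  field_simp
  ring

/-- The covariance integral in closed form, for `0 < y < 1`. -/
lemma logCov_closed_form (m : ℕ) {y : ℝ} (hy : 0 < y) (hy1 : y < 1) :
    logCov m y = dilog (1 - y) - ((harmonic m : ℚ) : ℝ) ^ 2
      + 2 * ∑ b ∈ Finset.Icc 1 m, ((harmonic (b - 1) : ℚ) : ℝ) / (b : ℝ)
      + ∑ b ∈ Finset.Icc 1 m, (1 / (b : ℝ)) *
          (((y - 1) / y) ^ b * Real.log (1 - y)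
            - ∑ t ∈ Finset.range (b - 1), ((y - 1) / y) ^ (t + 1) / ((b : ℝ) - (t : ℝ) - 1)) := by
  induction m with
  | zero =>
    have h := (hasSum_logCov 0 hy.le hy1).unique (f := _) (by
      convert! hasSum_dilog hy.le hy1 using 2 with k
      rw [betaCoeff_zero_left, div_div, ← sq])
    simp [h]
  | succ m ih =>
    have h1 := hasSum_logCov (m + 1) hy.le hy1
    have h2 := (hasSum_logCov m hy.le hy1).sub
      ((hasSum_pow_mul_betaCoeff (m + 1) hy hy1).div_const ((m : ℝ) + 1))
    have h3 := h1.unique (by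
      convert! h2 using 2 with k
      rw [betaCoeff_succ_div]; ring)
    -- The `t = 0` term of the finite sum contributes `-1 / (m+1)²`. This is also the increment of
    -- the harmonic terms, since `-H(m)² + 2 ∑ H(b-1)/b = -∑ 1/b²`.
    rw [h3, ih, Finset.sum_Icc_succ_top (by omega), Finset.sum_Icc_succ_top (by omega),
      harmonic_succ, Finset.sum_range_succ']
    simp only [Nat.add_sub_cancel]
    have e : ∀ t ∈ Finset.range m, ((y - 1) / y) ^ (t + 1) / (((m + 1 : ℕ) : ℝ) - ((t + 1 : ℕ) : ℝ))
        = ((y - 1) / y) ^ (t + 1) / (((m + 1 : ℕ) : ℝ) - (t : ℝ) - 1) := by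
      intro t _
      push_cast
      ring_nf
    rw [Finset.sum_congr rfl e]
    generalize ∑ t ∈ Finset.range m, ((y - 1) / y) ^ (t + 1) / (((m + 1 : ℕ) : ℝ) - (t : ℝ) - 1) = S
    push_cast
    have : (m : ℝ) + 1 ≠ 0 := by positivity
    simp only [pow_zero, sub_zero]
    field_simp
    ring_nf

/-! ### Logarithmic moments from Laplace transforms -/

section Laplace

variable {Ω : Type*} [MeasurableSpace Ω] {P : Measure Ω} [IsProbabilityMeasure P]
  {X Y : Ω → ℝ} {m : ℕ}

lemma integrable_exp_neg_mul (hX : AEMeasurable X P) (hX0 : ∀ᵐ ω ∂P, 0 ≤ X ω) {a : ℝ}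
    (ha : 0 ≤ a) : Integrable (fun ω => Real.exp (-(X ω * a))) P := by
  refine Integrable.mono' (integrable_const (1 : ℝ)) ?_ ?_
  · exact (Real.measurable_exp.comp_aemeasurable (hX.mul_const a).neg).aestronglyMeasurable
  · filter_upwards [hX0] with ω h
    rw [Real.norm_of_nonneg (Real.exp_pos _).le, Real.exp_le_one_iff]
    nlinarith

/-- Markov's inequality for `e^{-aX}` bounds the mass of `X ≤ 0` by the transform, which tends to
zero as `a` grows. -/
lemma ae_pos_of_laplace (hX : AEMeasurable X P) (hX0 : ∀ᵐ ω ∂P, 0 ≤ X ω)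
    (hL : ∀ a : ℝ, 0 < a → ∫ ω, Real.exp (-(X ω * a)) ∂P = ((1 + a) ^ (m + 1))⁻¹) :
    ∀ᵐ ω ∂P, 0 < X ω := by
  have hb : ∀ a : ℝ, 0 < a → P.real {ω | X ω ≤ 0} ≤ ((1 + a) ^ (m + 1))⁻¹ := by
    intro a ha
    have h := mul_meas_ge_le_integral_of_nonneg
      (ae_of_all P fun ω => (Real.exp_pos (-(X ω * a))).le)
      (integrable_exp_neg_mul hX hX0 ha.le) 1
    rw [one_mul, hL a ha] at h
    convert! h using 3
    ext ω
    rw [Real.one_le_exp_iff]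
    constructor <;> intro h <;> nlinarith
  have ht : Tendsto (fun a : ℝ => ((1 + a) ^ (m + 1))⁻¹) atTop (𝓝 0) :=
    tendsto_inv_atTop_zero.comp ((tendsto_pow_atTop (by omega)).comp
      (tendsto_atTop_add_const_left _ _ tendsto_id))
  have h0 : P.real {ω | X ω ≤ 0} ≤ 0 :=
    ge_of_tendsto ht ((eventually_gt_atTop 0).mono hb)
  have h1 : P {ω | X ω ≤ 0} = 0 := by
    rwa [← measureReal_eq_zero_iff, ← measureReal_nonneg.ge_iff_eq']
  rw [ae_iff]
  simpa using h1

lemma integrableOn_rpow_div_one_add (m : ℕ) :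
    IntegrableOn (fun t : ℝ => t ^ (-(1 / 2) : ℝ) * ((1 + t) ^ (m + 1))⁻¹) (Set.Ioi 0) := by
  have hd : ∀ x ∈ Set.Ioi (0 : ℝ), HasDerivAt (fun t : ℝ => 2 * Real.arctan (√t))
      (x ^ (-(1 / 2) : ℝ) * (1 + x)⁻¹) x := by
    intro x hx
    have hx : 0 < x := hx
    have h := ((Real.hasDerivAt_sqrt hx.ne').arctan).const_mul 2
    convert! h using 1
    rw [Real.sq_sqrt hx.le, Real.rpow_neg hx.le, ← Real.sqrt_eq_rpow]
    have : 0 < √x := Real.sqrt_pos.2 hx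
    field_simp
  have h1 : IntegrableOn (fun x : ℝ => x ^ (-(1 / 2) : ℝ) * (1 + x)⁻¹) (Set.Ioi 0) := by
    refine integrableOn_Ioi_deriv_of_nonneg (l := 2 * (Real.pi / 2))
      (Continuous.continuousWithinAt (by fun_prop)) hd
      (fun x hx => ?_) ?_
    · have hx : 0 < x := hx
      positivity
    · exact ((Real.tendsto_arctan_atTop.mono_right nhdsWithin_le_nhds).comp
        Real.tendsto_sqrt_atTop).const_mul 2
  refine Integrable.mono' h1 ?_ ?_
  · exact (by fun_prop : Measurable fun t : ℝ =>
      t ^ (-(1 / 2) : ℝ) * ((1 + t) ^ (m + 1))⁻¹).aestronglyMeasurable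
  · refine (ae_restrict_iff' measurableSet_Ioi).2 (ae_of_all _ fun x hx => ?_)
    have hx : 0 < x := hx
    rw [Real.norm_of_nonneg (by positivity)]
    gcongr
    exact le_self_pow₀ (by linarith) (by omega)

/-- Write `X^(-1/2)` as `Γ(1/2)⁻¹ ∫ t^(-1/2) e^{-Xt} dt` and exchange integrals. This moment
controls `log² X` near zero; the exponent `-1/2` works even for `m = 0`, where `X⁻¹` would not be
integrable. -/
lemma integrable_rpow_of_laplace (hX : AEMeasurable X P) (hX0 : ∀ᵐ ω ∂P, 0 ≤ X ω)
    (hL : ∀ a : ℝ, 0 < a → ∫ ω, Real.exp (-(X ω * a)) ∂P = ((1 + a) ^ (m + 1))⁻¹) :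
    Integrable (fun ω => (X ω) ^ (-(1 / 2) : ℝ)) P := by
  have hpos := ae_pos_of_laplace hX hX0 hL
  have hI : Integrable (fun p : ℝ × Ω => p.1 ^ (-(1 / 2) : ℝ) * Real.exp (-(X p.2 * p.1)))
      ((volume.restrict (Set.Ioi (0 : ℝ))).prod P) := by
    have hX' : AEMeasurable (fun p : ℝ × Ω => X p.2) ((volume.restrict (Set.Ioi (0 : ℝ))).prod P) :=
      hX.comp_quasiMeasurePreserving Measure.quasiMeasurePreserving_snd
    refine (integrable_prod_iff ?_).2 ⟨?_, ?_⟩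
    · exact AEMeasurable.aestronglyMeasurable (by fun_prop)
    · refine (ae_restrict_iff' measurableSet_Ioi).2 (ae_of_all _ fun t ht => ?_)
      exact (integrable_exp_neg_mul hX hX0 (le_of_lt ht)).const_mul (t ^ (-(1 / 2) : ℝ))
    · refine (integrableOn_rpow_div_one_add m).congr_fun (fun t ht => ?_) measurableSet_Ioi
      have ht : 0 < t := ht
      simp only
      rw [← hL t ht, ← integral_const_mul]
      refine integral_congr_ae (ae_of_all _ fun ω => ?_)
      exact (Real.norm_of_nonneg (by positivity)).symm
  have h := hI.integral_prod_right.const_mul (Real.Gamma (1 / 2))⁻¹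
  refine h.congr ?_
  filter_upwards [hpos] with ω hω
  have hg := Real.integral_rpow_mul_exp_neg_mul_Ioi (a := 1 / 2) (by norm_num) hω
  rw [show (1 / 2 - 1 : ℝ) = -(1 / 2) by norm_num] at hg
  have hG : Real.Gamma (1 / 2) ≠ 0 := (Real.Gamma_pos_of_pos (by norm_num)).ne'
  rw [hg, Real.rpow_neg hω.le, Real.div_rpow zero_le_one hω.le, Real.one_rpow]
  field_simp

lemma log_sq_le {x : ℝ} (hx : 0 < x) : Real.log x ^ 2 ≤ 16 * x ^ (-(1 / 2) : ℝ) + 4 * x := by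
  -- Both bounds are `log z ≤ z^ε / ε`, with `ε = 1/2` at `x` and `ε = 1/4` at `x⁻¹`; squaring gives
  -- the constants 4 and 16.
  have h1 : Real.log x ≤ 2 * x ^ (1 / 2 : ℝ) := by
    have := Real.log_le_rpow_div hx.le (ε := 1 / 2) (by norm_num)
    linarith
  have h2 : -Real.log x ≤ 4 * x ^ (-(1 / 4) : ℝ) := by
    have := Real.log_le_rpow_div (inv_pos.2 hx).le (ε := 1 / 4) (by norm_num)
    rw [Real.log_inv, Real.inv_rpow hx.le, ← Real.rpow_neg hx.le] at this
    linarith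
  have h3 : (x ^ (1 / 2 : ℝ)) ^ 2 = x := by
    rw [← Real.rpow_natCast, ← Real.rpow_mul hx.le]; norm_num
  have h4 : (x ^ (-(1 / 4) : ℝ)) ^ 2 = x ^ (-(1 / 2) : ℝ) := by
    rw [← Real.rpow_natCast, ← Real.rpow_mul hx.le]; norm_num
  have p1 : 0 < x ^ (1 / 2 : ℝ) := by positivity
  have p2 : 0 < x ^ (-(1 / 4) : ℝ) := by positivity
  rcases le_total 0 (Real.log x) with h | h
  · nlinarith
  · nlinarith

lemma memLp_log_of_laplace (hX : Integrable X P) (hX0 : ∀ᵐ ω ∂P, 0 ≤ X ω)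
    (hL : ∀ a : ℝ, 0 < a → ∫ ω, Real.exp (-(X ω * a)) ∂P = ((1 + a) ^ (m + 1))⁻¹) :
    MemLp (fun ω => Real.log (X ω)) 2 P := by
  have hXm := hX.aemeasurable
  have hm : AEStronglyMeasurable (fun ω => Real.log (X ω)) P :=
    (Real.measurable_log.comp_aemeasurable hXm).aestronglyMeasurable
  rw [memLp_two_iff_integrable_sq hm]
  refine Integrable.mono'
    (((integrable_rpow_of_laplace hXm hX0 hL).const_mul 16).add (hX.const_mul 4)) (hm.pow 2) ?_
  filter_upwards [ae_pos_of_laplace hXm hX0 hL] with ω h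
  rw [Real.norm_of_nonneg (sq_nonneg _)]
  exact log_sq_le h

lemma integral_log_of_laplace (hXm : AEMeasurable X P) (hpos : ∀ᵐ ω ∂P, 0 < X ω)
    (hlog : Integrable (fun ω => Real.log (X ω)) P)
    (hL : ∀ a : ℝ, 0 < a → ∫ ω, Real.exp (-(X ω * a)) ∂P = ((1 + a) ^ (m + 1))⁻¹) :
    Integrable (fun a : ℝ => a⁻¹ * (Real.exp (-a) - ((1 + a) ^ (m + 1))⁻¹))
      (volume.restrict (Set.Ioi (0 : ℝ))) ∧
    ∫ ω, Real.log (X ω) ∂P =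
      ∫ a in Set.Ioi (0 : ℝ), a⁻¹ * (Real.exp (-a) - ((1 + a) ^ (m + 1))⁻¹) := by
  have hX0 : ∀ᵐ ω ∂P, 0 ≤ X ω := hpos.mono fun _ h => h.le
  have hX' : AEMeasurable (fun p : Ω × ℝ => X p.1) (P.prod (volume.restrict (Set.Ioi (0 : ℝ)))) :=
    hXm.comp_quasiMeasurePreserving Measure.quasiMeasurePreserving_fst
  have hI : Integrable
      (fun p : Ω × ℝ => p.2⁻¹ * (Real.exp (-p.2) - Real.exp (-(X p.1 * p.2))))
      (P.prod (volume.restrict (Set.Ioi (0 : ℝ)))) := by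
    refine (integrable_prod_iff (AEMeasurable.aestronglyMeasurable (by fun_prop))).2 ⟨?_, ?_⟩
    · filter_upwards [hpos] with ω h using integrableOn_frullani h
    · refine hlog.abs.congr ?_
      filter_upwards [hpos] with ω h
      exact (integral_abs_frullani h).symm
  have hin : ∀ a ∈ Set.Ioi (0 : ℝ),
      ∫ ω, a⁻¹ * (Real.exp (-a) - Real.exp (-(X ω * a))) ∂P
        = a⁻¹ * (Real.exp (-a) - ((1 + a) ^ (m + 1))⁻¹) := by
    intro a ha
    have ha : 0 < a := ha
    rw [integral_const_mul, integral_sub (integrable_const _)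
      (integrable_exp_neg_mul hXm hX0 ha.le), hL a ha]
    simp
  constructor
  · exact IntegrableOn.congr_fun hI.integral_prod_right hin measurableSet_Ioi
  · rw [← setIntegral_congr_fun measurableSet_Ioi hin, ← integral_integral_swap hI]
    refine integral_congr_ae ?_
    filter_upwards [hpos] with ω h using (integral_frullani h).symm

lemma covariance_log_of_laplace {y : ℝ} (hXm : AEMeasurable X P) (hYm : AEMeasurable Y P)
    (hX : MemLp (fun ω => Real.log (X ω)) 2 P) (hY : MemLp (fun ω => Real.log (Y ω)) 2 P)
    (hXpos : ∀ᵐ ω ∂P, 0 < X ω) (hYpos : ∀ᵐ ω ∂P, 0 < Y ω)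
    (hLX : ∀ a : ℝ, 0 < a → ∫ ω, Real.exp (-(X ω * a)) ∂P = ((1 + a) ^ (m + 1))⁻¹)
    (hLY : ∀ a : ℝ, 0 < a → ∫ ω, Real.exp (-(Y ω * a)) ∂P = ((1 + a) ^ (m + 1))⁻¹)
    (hLXY : ∀ a b : ℝ, 0 < a → 0 < b →
      ∫ ω, Real.exp (-(X ω * a)) * Real.exp (-(Y ω * b)) ∂P =
        (((1 + a) * (1 + b) - y * (a * b)) ^ (m + 1))⁻¹) :
    cov[fun ω => Real.log (X ω), fun ω => Real.log (Y ω); P] = logCov m y := by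
  set ν := volume.restrict (Set.Ioi (0 : ℝ)) with hν
  have hX0 : ∀ᵐ ω ∂P, 0 ≤ X ω := hXpos.mono fun _ h => h.le
  have hY0 : ∀ᵐ ω ∂P, 0 ≤ Y ω := hYpos.mono fun _ h => h.le
  have hXY : Integrable (fun ω => Real.log (X ω) * Real.log (Y ω)) P := hX.integrable_mul hY
  have hX' : AEMeasurable (fun p : Ω × ℝ × ℝ => X p.1) (P.prod (ν.prod ν)) :=
    hXm.comp_quasiMeasurePreserving Measure.quasiMeasurePreserving_fst
  have hY' : AEMeasurable (fun p : Ω × ℝ × ℝ => Y p.1) (P.prod (ν.prod ν)) :=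
    hYm.comp_quasiMeasurePreserving Measure.quasiMeasurePreserving_fst
  have hI : Integrable
      (fun p : Ω × ℝ × ℝ => (p.2.1⁻¹ * (Real.exp (-p.2.1) - Real.exp (-(X p.1 * p.2.1)))) *
        (p.2.2⁻¹ * (Real.exp (-p.2.2) - Real.exp (-(Y p.1 * p.2.2)))))
      (P.prod (ν.prod ν)) := by
    refine (integrable_prod_iff (AEMeasurable.aestronglyMeasurable (by fun_prop))).2 ⟨?_, ?_⟩
    · filter_upwards [hXpos, hYpos] with ω h h'
      exact Integrable.mul_prod (integrableOn_frullani h) (integrableOn_frullani h')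
    · refine hXY.abs.congr ?_
      filter_upwards [hXpos, hYpos] with ω h h'
      simp only [norm_mul]
      rw [abs_mul, ← integral_abs_frullani h, ← integral_abs_frullani h', ← integral_prod_mul]
      simp only [abs_mul, Real.norm_eq_abs, hν]
  have h1 : ∫ ω, Real.log (X ω) * Real.log (Y ω) ∂P = ∫ p : ℝ × ℝ, ∫ ω,
      (p.1⁻¹ * (Real.exp (-p.1) - Real.exp (-(X ω * p.1)))) *
        (p.2⁻¹ * (Real.exp (-p.2) - Real.exp (-(Y ω * p.2)))) ∂P ∂(ν.prod ν) := by
    rw [← integral_integral_swap hI]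
    refine integral_congr_ae ?_
    filter_upwards [hXpos, hYpos] with ω h h'
    rw [← integral_frullani h, ← integral_frullani h', ← integral_prod_mul]
  have hpos : ∀ᵐ p ∂(ν.prod ν), 0 < p.1 ∧ 0 < p.2 := by
    rw [hν, Measure.prod_restrict, ae_restrict_iff' (measurableSet_Ioi.prod measurableSet_Ioi)]
    exact ae_of_all _ fun p hp => hp
  obtain ⟨iX, eX⟩ := integral_log_of_laplace hXm hXpos (hX.integrable (by norm_num)) hLX
  obtain ⟨iY, eY⟩ := integral_log_of_laplace hYm hYpos (hY.integrable (by norm_num)) hLY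
  rw [covariance_eq_sub hX hY]
  simp only [Pi.mul_apply]
  rw [h1, eX, eY, ← integral_prod_mul, logCov, ← integral_sub hI.integral_prod_right
    (Integrable.mul_prod iX iY)]
  refine integral_congr_ae ?_
  filter_upwards [hpos] with p hp
  obtain ⟨ha, hb⟩ := hp
  have iA := integrable_exp_neg_mul hXm hX0 ha.le
  have iB := integrable_exp_neg_mul hYm hY0 hb.le
  have iAB : Integrable (fun ω => Real.exp (-(X ω * p.1)) * Real.exp (-(Y ω * p.2))) P := by
    refine iA.mul_bdd (c := 1) iB.aestronglyMeasurable ?_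
    filter_upwards [hY0] with ω h
    rw [Real.norm_of_nonneg (Real.exp_pos _).le, Real.exp_le_one_iff]
    nlinarith
  -- Every term containing a deterministic `e^{-a}` or `e^{-b}` cancels against the product of the
  -- means, leaving the joint transform minus the product of the marginals.
  have e : ∀ ω, (p.1⁻¹ * (Real.exp (-p.1) - Real.exp (-(X ω * p.1)))) *
        (p.2⁻¹ * (Real.exp (-p.2) - Real.exp (-(Y ω * p.2)))) =
      (p.1⁻¹ * p.2⁻¹) * ((Real.exp (-p.1) * Real.exp (-p.2)
        - Real.exp (-p.1) * Real.exp (-(Y ω * p.2)))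
        - (Real.exp (-p.2) * Real.exp (-(X ω * p.1))
          - Real.exp (-(X ω * p.1)) * Real.exp (-(Y ω * p.2)))) := fun ω => by ring
  have i1 : Integrable (fun ω => Real.exp (-p.1) * Real.exp (-p.2)
      - Real.exp (-p.1) * Real.exp (-(Y ω * p.2))) P :=
    (integrable_const _).sub (iB.const_mul _)
  have i2 : Integrable (fun ω => Real.exp (-p.2) * Real.exp (-(X ω * p.1))
      - Real.exp (-(X ω * p.1)) * Real.exp (-(Y ω * p.2))) P :=
    (iA.const_mul _).sub iAB
  simp_rw [e]
  rw [integral_const_mul, integral_sub i1 i2, integral_sub (integrable_const _) (iB.const_mul _),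
    integral_sub (iA.const_mul _) iAB, hLXY _ _ ha hb, mul_pow, mul_inv]
  simp only [integral_const_mul, integral_const, probReal_univ, one_smul, hLX _ ha, hLY _ hb]
  ring

end Laplace

/-! ### The gamma distribution and the trigamma function -/

lemma integral_gammaMeasure (m : ℕ) (f : ℝ → ℝ) :
    ∫ x, f x ∂(gammaMeasure (m + 1) 1) =
      (m.factorial : ℝ)⁻¹ * ∫ x in Set.Ioi (0 : ℝ), x ^ m * Real.exp (-x) * f x := by
  rw [gammaMeasure, integral_withDensity_eq_integral_toReal_smul₀
    (f := gammaPDF (m + 1) 1)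
    (measurable_gammaPDFReal _ _).ennreal_ofReal.aemeasurable
    (ae_of_all _ fun _ => ENNReal.ofReal_lt_top), ← integral_const_mul,
    ← integral_Ici_eq_integral_Ioi, ← integral_indicator measurableSet_Ici]
  refine integral_congr_ae (ae_of_all _ fun x => ?_)
  have h0 := gammaPDFReal_nonneg (a := m + 1) (r := 1) (by positivity) one_pos x
  simp only [gammaPDF, ENNReal.toReal_ofReal h0, smul_eq_mul]
  by_cases hx : 0 ≤ x
  · rw [Set.indicator_of_mem (Set.mem_Ici.2 hx), gammaPDFReal, if_pos hx,
      Real.Gamma_nat_eq_factorial]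
    simp
    ring
  · rw [Set.indicator_of_notMem (by simpa using hx), gammaPDFReal, if_neg hx, zero_mul]

lemma ae_gammaMeasure_pos (m : ℕ) : ∀ᵐ x ∂(gammaMeasure (m + 1) 1), 0 ≤ x := by
  rw [ae_iff, gammaMeasure, withDensity_apply' ]
  have : {a : ℝ | ¬ 0 ≤ a} = Set.Iio 0 := by ext; simp
  rw [this]
  exact lintegral_gammaPDF_of_nonpos le_rfl

lemma integral_exp_gammaMeasure (m : ℕ) {a : ℝ} (ha : 0 < 1 + a) :
    ∫ x, Real.exp (-(x * a)) ∂(gammaMeasure (m + 1) 1) = ((1 + a) ^ (m + 1))⁻¹ := by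
  rw [integral_gammaMeasure]
  have h := Real.integral_rpow_mul_exp_neg_mul_Ioi (a := m + 1) (by positivity) ha
  have e : ∫ x in Set.Ioi (0 : ℝ), x ^ m * Real.exp (-x) * Real.exp (-(x * a))
      = ∫ x in Set.Ioi (0 : ℝ), x ^ ((m : ℝ) + 1 - 1) * Real.exp (-((1 + a) * x)) := by
    refine setIntegral_congr_fun measurableSet_Ioi fun x hx => ?_
    rw [add_sub_cancel_right, Real.rpow_natCast, mul_assoc, ← Real.exp_add]
    ring_nf
  rw [e, h, Real.Gamma_nat_eq_factorial]
  have : (m.factorial : ℝ) ≠ 0 := by positivity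
  rw [show (m : ℝ) + 1 = ((m + 1 : ℕ) : ℝ) by push_cast; ring, Real.rpow_natCast, one_div,
    inv_pow]
  field_simp

lemma integrable_id_gammaMeasure (m : ℕ) : Integrable (fun x : ℝ => x) (gammaMeasure (m + 1) 1) := by
  rw [gammaMeasure, integrable_withDensity_iff_integrable_smul₀'
    (f := gammaPDF (m + 1) 1) (measurable_gammaPDFReal _ _).ennreal_ofReal.aemeasurable
    (ae_of_all _ fun _ => ENNReal.ofReal_lt_top)]
  have h := (Real.GammaIntegral_convergent (s := m + 2) (by positivity)).const_mul
    (m.factorial : ℝ)⁻¹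
  rw [← IntegrableOn, ← integrableOn_Ici_iff_integrableOn_Ioi,
    ← integrable_indicator_iff measurableSet_Ici] at h
  refine h.congr (ae_of_all _ fun x => ?_)
  have h0 := gammaPDFReal_nonneg (a := m + 1) (r := 1) (by positivity) one_pos x
  simp only [gammaPDF, ENNReal.toReal_ofReal h0, smul_eq_mul]
  by_cases hx : 0 ≤ x
  · rw [Set.indicator_of_mem (Set.mem_Ici.2 hx), gammaPDFReal, if_pos hx,
      Real.Gamma_nat_eq_factorial, show (m : ℝ) + 2 - 1 = ((m + 1 : ℕ) : ℝ) by push_cast; ring,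
      Real.rpow_natCast]
    simp
    ring
  · rw [Set.indicator_of_notMem (by simpa using hx), gammaPDFReal, if_neg hx, zero_mul]

lemma mellin_ofReal_natCast_add_one (m : ℕ) (f : ℝ → ℝ) :
    mellin (fun t => ((f t : ℝ) : ℂ)) ((m : ℂ) + 1) =
      ((∫ t in Set.Ioi (0 : ℝ), t ^ m * f t : ℝ) : ℂ) := by
  rw [mellin, ← integral_complex_ofReal]
  refine setIntegral_congr_fun measurableSet_Ioi fun t _ => ?_
  simp

lemma isBigO_exp_neg_atTop (a : ℝ) :
    (fun t : ℝ => ((Real.exp (-t) : ℝ) : ℂ)) =O[atTop] (· ^ (-a) : ℝ → ℝ) := by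
  rw [← Asymptotics.isBigO_norm_left]
  simp_rw [Complex.norm_real, Asymptotics.isBigO_norm_left]
  simpa only [neg_one_mul] using (isLittleO_exp_neg_mul_rpow_atTop zero_lt_one _).isBigO

lemma isBigO_exp_neg_zero :
    (fun t : ℝ => ((Real.exp (-t) : ℝ) : ℂ)) =O[𝓝[>] 0] (· ^ (-(0 : ℝ)) : ℝ → ℝ) := by
  simp_rw [neg_zero, Real.rpow_zero]
  refine Asymptotics.isBigO_const_of_tendsto (?_ : Tendsto _ _ (𝓝 (1 : ℂ))) one_ne_zero
  have : Tendsto (fun t : ℝ => ((Real.exp (-t) : ℝ) : ℂ)) (𝓝 0)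
      (𝓝 ((Real.exp (-0) : ℝ) : ℂ)) := Continuous.tendsto (by fun_prop) 0
  simpa using this.mono_left nhdsWithin_le_nhds

lemma hasDerivAt_Gamma_mellin {s : ℂ} (hs : 0 < s.re) :
    HasDerivAt Complex.Gamma
      (mellin (fun t => ((Real.log t * Real.exp (-t) : ℝ) : ℂ)) s) s := by
  have h := (mellin_hasDerivAt_of_isBigO_rpow (E := ℂ) (s := s)
    (f := fun t => ((Real.exp (-t) : ℝ) : ℂ))
    ((Continuous.continuousOn (by fun_prop)).locallyIntegrableOn measurableSet_Ioi)
    (isBigO_exp_neg_atTop (s.re + 1)) (lt_add_one _) isBigO_exp_neg_zero hs).2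
  rw [← Complex.GammaIntegral_eq_mellin] at h
  have : IsOpen {s : ℂ | 0 < s.re} := Complex.continuous_re.isOpen_preimage _ isOpen_Ioi
  refine (h.congr_of_eventuallyEq ?_).congr_deriv ?_
  · filter_upwards [this.mem_nhds hs] with a ha using Complex.Gamma_eq_integral ha
  · congr 1; ext t; simp

/-- The threshold `1/2` comes from bounding `log t` by `t^(-1/2)` at zero. It suffices, as the only
points needed are the integers `m + 1 ≥ 1`. -/
lemma hasDerivAt_mellin_log_exp {s : ℂ} (hs : 1 / 2 < s.re) :
    HasDerivAt (mellin (fun t => ((Real.log t * Real.exp (-t) : ℝ) : ℂ)))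
      (mellin (fun t => ((Real.log t * (Real.log t * Real.exp (-t)) : ℝ) : ℂ)) s) s := by
  have hlog : (fun t : ℝ => ((Real.log t : ℝ) : ℂ)) =O[atTop] (· ^ (1 : ℝ) : ℝ → ℝ) := by
    rw [← Asymptotics.isBigO_norm_left]
    simp_rw [Complex.norm_real, Asymptotics.isBigO_norm_left]
    exact (isLittleO_log_rpow_atTop one_pos).isBigO
  have hlog0 : (fun t : ℝ => ((Real.log t : ℝ) : ℂ)) =O[𝓝[>] 0] (· ^ (-(1 / 2) : ℝ) : ℝ → ℝ) := by
    rw [← Asymptotics.isBigO_norm_left]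
    simp_rw [Complex.norm_real, Asymptotics.isBigO_norm_left]
    exact (isLittleO_log_rpow_nhdsGT_zero (by norm_num)).isBigO
  have h := (mellin_hasDerivAt_of_isBigO_rpow (E := ℂ) (s := s)
    (f := fun t => ((Real.log t * Real.exp (-t) : ℝ) : ℂ)) (a := s.re + 1) (b := 1 / 2)
    ?_ ?_ (lt_add_one _) ?_ hs).2
  · refine h.congr_deriv ?_
    congr 1; ext t; simp
  · refine ContinuousOn.locallyIntegrableOn ?_ measurableSet_Ioi
    refine Complex.continuous_ofReal.comp_continuousOn (ContinuousOn.mul ?_ (by fun_prop))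
    exact Real.continuousOn_log.mono fun x hx => ne_of_gt hx
  · refine ((hlog.mul (isBigO_exp_neg_atTop (s.re + 2))).congr' ?_ ?_)
    · exact Eventually.of_forall fun t => by simp
    · filter_upwards [eventually_gt_atTop 0] with t ht
      rw [← Real.rpow_add ht]
      ring_nf
  · refine ((hlog0.mul isBigO_exp_neg_zero).congr' ?_ ?_)
    · exact Eventually.of_forall fun t => by simp
    · exact Eventually.of_forall fun t => by simp

/-- Take both variables equal to one gamma variable of shape `m + 1`: its transform at `a + b` is
the joint transform at `y = 1`, because `1 + a + b = (1 + a)(1 + b) - a b`. The variance of its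
logarithm is `(Γ'' Γ - Γ'²) / Γ²`, the derivative of digamma. -/
lemma trigamma_eq_logCov (m : ℕ) : trigamma ((m + 1 : ℕ) : ℝ) = logCov m 1 := by
  have hprob : IsProbabilityMeasure (gammaMeasure (m + 1) 1) :=
    isProbabilityMeasure_gammaMeasure (by positivity) one_pos
  set μ := gammaMeasure (m + 1) 1 with hμ
  have hL : ∀ a : ℝ, 0 < a → ∫ x, Real.exp (-(x * a)) ∂μ = ((1 + a) ^ (m + 1))⁻¹ :=
    fun a ha => integral_exp_gammaMeasure m (by linarith)
  have hm := memLp_log_of_laplace (integrable_id_gammaMeasure m) (ae_gammaMeasure_pos m) hL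
  have hpos := ae_pos_of_laplace aemeasurable_id' (ae_gammaMeasure_pos m) hL
  have hcov := covariance_log_of_laplace (y := 1) aemeasurable_id' aemeasurable_id' hm hm hpos hpos
    hL hL (fun a b ha hb => by
      simp_rw [← Real.exp_add, ← neg_add, ← mul_add]
      rw [integral_exp_gammaMeasure m (by linarith)]
      ring_nf)
  rw [covariance_eq_sub hm hm] at hcov
  simp only [Pi.mul_apply] at hcov
  rw [integral_gammaMeasure, integral_gammaMeasure] at hcov
  have e1 : ∀ x : ℝ, x ^ m * Real.exp (-x) * (Real.log x * Real.log x)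
    = x ^ m * (Real.log x * (Real.log x * Real.exp (-x))) := fun x => by ring
  have e2 : ∀ x : ℝ, x ^ m * Real.exp (-x) * Real.log x
    = x ^ m * (Real.log x * Real.exp (-x)) := fun x => by ring
  simp_rw [e1, e2] at hcov
  set s : ℂ := (m : ℂ) + 1 with hs
  have hsre : s.re = m + 1 := by simp [hs]
  have hm0 : (0 : ℝ) ≤ m := Nat.cast_nonneg m
  have hopen : IsOpen {s : ℂ | 0 < s.re} := Complex.continuous_re.isOpen_preimage _ isOpen_Ioi
  have hG : Complex.Gamma s = (m.factorial : ℂ) := Complex.Gamma_nat_eq_factorial m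
  have hG0 : (m.factorial : ℂ) ≠ 0 := by exact_mod_cast m.factorial_ne_zero
  have hd : deriv Complex.digamma s =
      (mellin (fun t => ((Real.log t * (Real.log t * Real.exp (-t)) : ℝ) : ℂ)) s
        * Complex.Gamma s - mellin (fun t => ((Real.log t * Real.exp (-t) : ℝ) : ℂ)) s
        * mellin (fun t => ((Real.log t * Real.exp (-t) : ℝ) : ℂ)) s) / Complex.Gamma s ^ 2 := by
    have h := (hasDerivAt_mellin_log_exp (s := s) (by rw [hsre]; linarith)).div
      (hasDerivAt_Gamma_mellin (s := s) (by rw [hsre]; linarith)) (by rw [hG]; exact hG0)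
    rw [← h.deriv]
    refine Filter.EventuallyEq.deriv_eq ?_
    filter_upwards [hopen.mem_nhds (show 0 < s.re by rw [hsre]; linarith)] with z hz
    rw [Complex.digamma_def, logDeriv_apply, (hasDerivAt_Gamma_mellin hz).deriv]
    rfl
  rw [← hcov, trigamma]
  have hc : (((m + 1 : ℕ) : ℝ) : ℂ) = s := by rw [hs]; push_cast; ring
  rw [hc, hd, hG, mellin_ofReal_natCast_add_one, mellin_ofReal_natCast_add_one]
  have hf : (m.factorial : ℝ) ≠ 0 := by positivity
  norm_cast
  push_cast
  field_simp

/-- For `r = |ρ| ≤ 1`, the function `phiTilde` is the covariance integral at `r²`. -/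
lemma phiTilde_eq_logCov (m : ℕ) {r : ℝ} (hr : 0 ≤ r) (hr1 : r ≤ 1) :
    phiTilde (m + 1) r = logCov m (r ^ 2) := by
  unfold phiTilde
  split_ifs with h0 h1
  · rw [h0, zero_pow two_ne_zero, logCov_zero]
  · rw [h1, one_pow, ← trigamma_eq_logCov]
  · have hr0 : 0 < r := lt_of_le_of_ne hr (Ne.symm h0)
    have hr2 : r < 1 := lt_of_le_of_ne hr1 h1
    rw [logCov_closed_form m (by positivity) (by nlinarith)]
    simp only [Nat.add_sub_cancel]

/-! ### Gaussian integrals -/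

lemma integral_cexp_gaussianReal {a : ℝ} (ha : 0 < 1 + a) (α : ℂ) :
    ∫ x : ℝ, Complex.exp (-(a * (x : ℂ) ^ 2) + α * x) ∂(gaussianReal 0 (1 / 2)) =
      ((√(1 + a))⁻¹ : ℝ) * Complex.exp (α ^ 2 / (4 * (1 + a))) := by
  rw [integral_gaussianReal_eq_integral_smul (by norm_num)]
  have e : ∀ x : ℝ, gaussianPDFReal 0 (1 / 2) x • Complex.exp (-(a * (x : ℂ) ^ 2) + α * x)
      = ((√Real.pi)⁻¹ : ℝ) * Complex.exp (-((1 + a : ℝ) : ℂ) * x ^ 2 + α * x + 0) := by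
    intro x
    rw [gaussianPDFReal, Complex.real_smul, Complex.ofReal_mul, mul_assoc, Complex.ofReal_exp,
      ← Complex.exp_add]
    congr 2
    · rw [show 2 * Real.pi * ((1 / 2 : NNReal) : ℝ) = Real.pi by push_cast; ring]
    · push_cast; simp; ring
  have hre : (-((1 + a : ℝ) : ℂ)).re < 0 := by
    rw [Complex.neg_re, Complex.ofReal_re]; linarith
  have hpi : (√Real.pi : ℝ) ≠ 0 := (Real.sqrt_pos.2 Real.pi_pos).ne'
  have h2 : ((Real.pi : ℂ) / - -((1 + a : ℝ) : ℂ)) ^ (1 / 2 : ℂ)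
      = ((√Real.pi / √(1 + a) : ℝ) : ℂ) := by
    rw [neg_neg, ← Complex.ofReal_div,
      show (1 / 2 : ℂ) = ((1 / 2 : ℝ) : ℂ) by push_cast; rfl,
      ← Complex.ofReal_cpow (div_nonneg Real.pi_pos.le ha.le), ← Real.sqrt_eq_rpow,
      Real.sqrt_div Real.pi_pos.le]
  simp_rw [e]
  rw [integral_const_mul, integral_cexp_quadratic hre, h2, ← mul_assoc, ← Complex.ofReal_mul]
  have ha' : (1 + a : ℂ) ≠ 0 := by exact_mod_cast ha.ne'
  congr 2
  · field_simp
  · push_cast; field_simp; ring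

instance : IsProbabilityMeasure complexGaussian := by
  unfold complexGaussian
  exact Measure.isProbabilityMeasure_map (by fun_prop)

/-- Complex `α` and `β` let one formula serve both for characteristic functions (imaginary, `a = 0`)
and for completing squares (real). -/
lemma integral_cexp_complexGaussian {a : ℝ} (ha : 0 < 1 + a) (α β : ℂ) :
    ∫ z : ℂ, Complex.exp (-((a * ‖z‖ ^ 2 : ℝ) : ℂ) + (α * z.re + β * z.im)) ∂complexGaussian =
      ((1 + a)⁻¹ : ℝ) * Complex.exp ((α ^ 2 + β ^ 2) / (4 * (1 + a))) := by
  rw [complexGaussian, integral_map (by fun_prop)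
    (Continuous.aestronglyMeasurable (by fun_prop))]
  have e : ∀ p : ℝ × ℝ, Complex.exp (-((a * ‖(p.1 : ℂ) + (p.2 : ℂ) * Complex.I‖ ^ 2 : ℝ) : ℂ)
      + (α * ((p.1 : ℂ) + (p.2 : ℂ) * Complex.I).re + β * ((p.1 : ℂ) + (p.2 : ℂ) * Complex.I).im))
      = Complex.exp (-(a * (p.1 : ℂ) ^ 2) + α * p.1)
        * Complex.exp (-(a * (p.2 : ℂ) ^ 2) + β * p.2) := by
    intro p
    rw [Complex.sq_norm, Complex.normSq_add_mul_I, ← Complex.exp_add]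
    congr 1
    simp
    ring
  simp_rw [e]
  rw [integral_prod_mul (fun x : ℝ => Complex.exp (-(a * (x : ℂ) ^ 2) + α * x))
    (fun x : ℝ => Complex.exp (-(a * (x : ℂ) ^ 2) + β * x)), integral_cexp_gaussianReal ha,
    integral_cexp_gaussianReal ha, mul_mul_mul_comm, ← Complex.exp_add, ← Complex.ofReal_mul,
    ← mul_inv, Real.mul_self_sqrt ha.le, add_div]

/-- The characteristic function of the law `CN(0,1)`. -/
lemma integral_cexp_re_complexGaussian (w : ℂ) :
    ∫ z : ℂ, Complex.exp (Complex.I * ((w * z).re : ℂ)) ∂complexGaussian =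
      Complex.exp (-((‖w‖ ^ 2 / 4 : ℝ) : ℂ)) := by
  have h := integral_cexp_complexGaussian (a := 0) (by norm_num)
    (Complex.I * w.re) (-(Complex.I * w.im))
  convert! h using 1
  · refine integral_congr_ae (ae_of_all _ fun z => ?_)
    simp only [Complex.mul_re]
    congr 1
    push_cast
    ring
  · rw [Complex.sq_norm, Complex.normSq_apply]
    push_cast
    rw [add_zero, inv_one, one_mul]
    congr 1
    ring_nf
    rw [Complex.I_sq]
    ring

/-- The exponential of a negative squared modulus as a Gaussian mixture of characters. -/
lemma cexp_neg_mul_sq_norm_eq_integral {a : ℝ} (ha : 0 ≤ a) (u : ℂ) :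
    Complex.exp (-((a * ‖u‖ ^ 2 : ℝ) : ℂ)) =
      ∫ z : ℂ, Complex.exp (Complex.I * ((2 * √a * (star z * u).re : ℝ) : ℂ)) ∂complexGaussian := by
  -- The factor `2 √a` offsets the `1/4` in the characteristic function.
  have h := integral_cexp_re_complexGaussian ((2 * √a : ℝ) * star u)
  rw [norm_mul, norm_star, Complex.norm_real, mul_pow, Real.norm_of_nonneg (by positivity),
    mul_pow, Real.sq_sqrt ha] at h
  rw [show a * ‖u‖ ^ 2 = 2 ^ 2 * a * ‖u‖ ^ 2 / 4 by ring, ← h]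
  refine integral_congr_ae (ae_of_all _ fun z => ?_)
  simp [Complex.mul_re, Complex.mul_im]
  ring_nf

/-- Integrating out the first variable by completing the square leaves a Gaussian integral in the
second, with coefficient `b - a b |ρ|² / (1 + a)`, nonnegative because `|ρ| ≤ 1`. -/
lemma integral_pair_complexGaussian {a b : ℝ} (ha : 0 ≤ a) (hb : 0 ≤ b) {ρ : ℂ} (hρ : ‖ρ‖ ≤ 1) :
    ∫ q : ℂ × ℂ, Complex.exp (-((a * ‖q.1‖ ^ 2 + b * ‖q.2‖ ^ 2
        + 2 * √a * √b * (star q.1 * q.2 * ρ).re : ℝ) : ℂ)) ∂(complexGaussian.prod complexGaussian)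
      = ((((1 + a) * (1 + b) - ‖ρ‖ ^ 2 * (a * b))⁻¹ : ℝ) : ℂ) := by
  have hr : ‖ρ‖ ^ 2 ≤ 1 := by nlinarith [norm_nonneg ρ]
  have h1a : 0 < 1 + a := by linarith
  have hfrac : a * b * ‖ρ‖ ^ 2 / (1 + a) ≤ b := by
    rw [div_le_iff₀ h1a]
    have : a * b * ‖ρ‖ ^ 2 ≤ a * b * 1 := by gcongr
    nlinarith
  have h1b : 0 < 1 + (b - a * b * ‖ρ‖ ^ 2 / (1 + a)) := by linarith
  have hmeas : AEStronglyMeasurable (fun q : ℂ × ℂ => Complex.exp (-((a * ‖q.1‖ ^ 2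
      + b * ‖q.2‖ ^ 2 + 2 * √a * √b * (star q.1 * q.2 * ρ).re : ℝ) : ℂ)))
      (complexGaussian.prod complexGaussian) :=
    Continuous.aestronglyMeasurable (by fun_prop)
  have hint : Integrable (fun q : ℂ × ℂ => Complex.exp (-((a * ‖q.1‖ ^ 2
      + b * ‖q.2‖ ^ 2 + 2 * √a * √b * (star q.1 * q.2 * ρ).re : ℝ) : ℂ)))
      (complexGaussian.prod complexGaussian) := by
    refine Integrable.mono' (integrable_const (1 : ℝ)) hmeas (ae_of_all _ fun q => ?_)
    rw [← Complex.ofReal_neg, Complex.norm_exp_ofReal, Real.exp_le_one_iff]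
    have h3 : -(‖q.1‖ * ‖q.2‖) ≤ (star q.1 * q.2 * ρ).re := by
      have h4 := Complex.abs_re_le_norm (star q.1 * q.2 * ρ)
      rw [norm_mul, norm_mul, norm_star] at h4
      have h5 : ‖q.1‖ * ‖q.2‖ * ‖ρ‖ ≤ ‖q.1‖ * ‖q.2‖ * 1 := by gcongr
      linarith [neg_abs_le (star q.1 * q.2 * ρ).re]
    have h6 : 2 * √a * √b * -(‖q.1‖ * ‖q.2‖) ≤ 2 * √a * √b * (star q.1 * q.2 * ρ).re := by gcongr
    nlinarith [sq_nonneg (√a * ‖q.1‖ - √b * ‖q.2‖), Real.sq_sqrt ha, Real.sq_sqrt hb]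
  rw [integral_prod_symm _ hint]
  have hin : ∀ w : ℂ, ∫ z : ℂ, Complex.exp (-((a * ‖z‖ ^ 2 + b * ‖w‖ ^ 2
        + 2 * √a * √b * (star z * w * ρ).re : ℝ) : ℂ)) ∂complexGaussian
      = ((1 + a)⁻¹ : ℝ) * Complex.exp (-(((b - a * b * ‖ρ‖ ^ 2 / (1 + a)) * ‖w‖ ^ 2 : ℝ) : ℂ)
        + (0 * w.re + 0 * w.im)) := by
    intro w
    have h := integral_cexp_complexGaussian h1a
      ((-(2 * √a * √b * (w * ρ).re) : ℝ) : ℂ) ((-(2 * √a * √b * (w * ρ).im) : ℝ) : ℂ)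
    have e : ∀ z : ℂ, Complex.exp (-((a * ‖z‖ ^ 2 + b * ‖w‖ ^ 2
        + 2 * √a * √b * (star z * w * ρ).re : ℝ) : ℂ)) =
        Complex.exp (-((b * ‖w‖ ^ 2 : ℝ) : ℂ)) * Complex.exp (-((a * ‖z‖ ^ 2 : ℝ) : ℂ)
          + (((-(2 * √a * √b * (w * ρ).re) : ℝ) : ℂ) * z.re
            + ((-(2 * √a * √b * (w * ρ).im) : ℝ) : ℂ) * z.im)) := by
      intro z
      rw [← Complex.exp_add]
      congr 1
      norm_cast
      rw [mul_assoc (star z), Complex.mul_re (star z)]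
      simp
      ring
    simp_rw [e]
    rw [integral_const_mul, h, mul_left_comm, ← Complex.exp_add]
    congr 2
    norm_cast
    simp only [zero_mul, add_zero]
    norm_cast
    have h7 : (2 * √a * √b * (w * ρ).re) ^ 2 + (2 * √a * √b * (w * ρ).im) ^ 2
        = 4 * (a * b * ‖ρ‖ ^ 2 * ‖w‖ ^ 2) := by
      have h8 : ‖w‖ ^ 2 * ‖ρ‖ ^ 2 = (w * ρ).re ^ 2 + (w * ρ).im ^ 2 := by
        rw [← mul_pow, ← norm_mul, Complex.sq_norm, Complex.normSq_apply]; ring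
      calc _ = 4 * (√a ^ 2 * √b ^ 2) * ((w * ρ).re ^ 2 + (w * ρ).im ^ 2) := by ring
        _ = _ := by rw [Real.sq_sqrt ha, Real.sq_sqrt hb, ← h8]; ring
    rw [neg_sq, neg_sq, h7]
    field_simp
    ring
  simp_rw [hin]
  rw [integral_const_mul, integral_cexp_complexGaussian h1b]
  simp only [ne_eq, OfNat.ofNat_ne_zero, not_false_eq_true, zero_pow, add_zero, zero_div,
    Complex.exp_zero, mul_one]
  norm_cast
  rw [← mul_inv]
  congr 1
  field_simp
  ring

/-! ### The joint Laplace transform of two correlated Gaussian vectors -/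

section Gaussian

variable {Ω : Type*} [MeasurableSpace Ω] {P : Measure Ω}
  {ι κ : Type*} [Fintype ι] [Fintype κ] {h : ι × κ → Ω → ℂ}

lemma integral_cexp_re_sum (hind : iIndepFun h P) (hlaw : ∀ q, HasLaw (h q) complexGaussian P)
    (w : ι × κ → ℂ) :
    ∫ ω, ∏ q, Complex.exp (Complex.I * ((w q * h q ω).re : ℂ)) ∂P =
      ∏ q, Complex.exp (-((‖w q‖ ^ 2 / 4 : ℝ) : ℂ)) := by
  rw [hind.integral_fun_prod_comp (f := fun q z => Complex.exp (Complex.I * ((w q * z).re : ℂ)))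
    (fun q => (hlaw q).aemeasurable)
    (fun q => Continuous.aestronglyMeasurable (by fun_prop))]
  refine Finset.prod_congr rfl fun q _ => ?_
  rw [← integral_cexp_re_complexGaussian, ← (hlaw q).map_eq,
    integral_map (hlaw q).aemeasurable (Continuous.aestronglyMeasurable (by fun_prop))]

/-- The exponent left after averaging over the channel: normalisation yields the square terms, and
the channel enters only through the correlation of `c` and `d`. -/
lemma sum_norm_sq_add (c d : ι → ℂ) (hc : ∑ p, ‖c p‖ ^ 2 = 1) (hd : ∑ p, ‖d p‖ ^ 2 = 1)
    {a b : ℝ} (ha : 0 ≤ a) (hb : 0 ≤ b) (z w : ℂ) :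
    ∑ p, ‖((2 * √a : ℝ) : ℂ) * star z * c p + ((2 * √b : ℝ) : ℂ) * star w * d p‖ ^ 2 / 4 =
      a * ‖z‖ ^ 2 + b * ‖w‖ ^ 2
        + 2 * √a * √b * (star z * w * ∑ p, c p * star (d p)).re := by
  have e : ∀ p, ‖((2 * √a : ℝ) : ℂ) * star z * c p + ((2 * √b : ℝ) : ℂ) * star w * d p‖ ^ 2 / 4
      = a * ‖z‖ ^ 2 * ‖c p‖ ^ 2 + b * ‖w‖ ^ 2 * ‖d p‖ ^ 2
        + 2 * √a * √b * (star z * w * (c p * star (d p))).re := by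
    intro p
    have h1 := Real.sq_sqrt ha
    have h2 := Real.sq_sqrt hb
    rw [Complex.sq_norm, Complex.normSq_add, ← Complex.sq_norm, ← Complex.sq_norm]
    simp only [norm_mul, norm_star, Complex.norm_real, mul_pow, Real.norm_eq_abs, sq_abs]
    rw [h1, h2]
    have h3 : (((2 * √a : ℝ) : ℂ) * star z * c p
        * (starRingEnd ℂ) (((2 * √b : ℝ) : ℂ) * star w * d p))
        = ((4 * √a * √b : ℝ) : ℂ) * (star z * w * (c p * star (d p))) := by
      simp only [map_mul, Complex.conj_ofReal, Complex.star_def, Complex.conj_conj]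
      push_cast
      ring
    rw [h3, Complex.re_ofReal_mul]
    ring
  simp_rw [e]
  rw [Finset.sum_add_distrib, Finset.sum_add_distrib, ← Finset.mul_sum, ← Finset.mul_sum, hc, hd,
    ← Finset.mul_sum, ← Complex.re_sum, ← Finset.mul_sum, mul_one, mul_one]

/-- Auxiliary Gaussian pairs `ζ i` make the exponents linear in `h`. After the integrals are
exchanged, independence averages out `h`, and the `ζ`-integral splits over `κ` into identical pair
integrals. -/
lemma integral_exp_neg_mul_pair [IsProbabilityMeasure P] (hind : iIndepFun h P)
    (hlaw : ∀ q, HasLaw (h q) complexGaussian P) (c d : ι → ℂ)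
    (hc : ∑ p, ‖c p‖ ^ 2 = 1) (hd : ∑ p, ‖d p‖ ^ 2 = 1)
    (hρ : ‖∑ p, c p * star (d p)‖ ≤ 1) {a b : ℝ} (ha : 0 ≤ a) (hb : 0 ≤ b) :
    ∫ ω, Real.exp (-((∑ i, ‖∑ p, c p * h (p, i) ω‖ ^ 2) * a))
        * Real.exp (-((∑ i, ‖∑ p, d p * h (p, i) ω‖ ^ 2) * b)) ∂P =
      (((1 + a) * (1 + b) - ‖∑ p, c p * star (d p)‖ ^ 2 * (a * b)) ^ Fintype.card κ)⁻¹ := by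
  classical
  have hm : ∀ q, AEMeasurable (h q) P := fun q => (hlaw q).aemeasurable
  set M : Measure (κ → ℂ × ℂ) := Measure.pi fun _ => complexGaussian.prod complexGaussian with hM
  let w : (κ → ℂ × ℂ) → ι × κ → ℂ := fun ζ q =>
    ((2 * √a : ℝ) : ℂ) * star (ζ q.2).1 * c q.1 + ((2 * √b : ℝ) : ℂ) * star (ζ q.2).2 * d q.1
  let G : Ω → (κ → ℂ × ℂ) → ℂ := fun ω ζ =>
    ∏ q, Complex.exp (Complex.I * ((w ζ q * h q ω).re : ℂ))
  have hG : ∀ ω ζ, G ω ζ = ∏ i,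
      (Complex.exp (Complex.I * ((2 * √a * (star (ζ i).1 * ∑ p, c p * h (p, i) ω).re : ℝ) : ℂ)) *
        Complex.exp (Complex.I *
          ((2 * √b * (star (ζ i).2 * ∑ p, d p * h (p, i) ω).re : ℝ) : ℂ))) := by
    intro ω ζ
    simp only [G, w]
    rw [Fintype.prod_prod_type_right]
    refine Finset.prod_congr rfl fun i _ => ?_
    rw [← Complex.exp_sum, ← Complex.exp_add, ← Finset.mul_sum, ← mul_add, ← Complex.ofReal_sum,
      ← Complex.ofReal_add]
    congr 3
    rw [← Complex.re_ofReal_mul, ← Complex.re_ofReal_mul, ← Complex.add_re, ← Complex.re_sum]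
    congr 1
    rw [Finset.mul_sum, Finset.mul_sum, Finset.mul_sum, Finset.mul_sum, ← Finset.sum_add_distrib]
    exact Finset.sum_congr rfl fun p _ => by ring
  have h1 : ∀ ω, ((Real.exp (-((∑ i, ‖∑ p, c p * h (p, i) ω‖ ^ 2) * a))
        * Real.exp (-((∑ i, ‖∑ p, d p * h (p, i) ω‖ ^ 2) * b)) : ℝ) : ℂ) = ∫ ζ, G ω ζ ∂M := by
    intro ω
    simp_rw [hG]
    rw [hM, integral_fintype_prod_eq_prod (fun i (q : ℂ × ℂ) =>
      (Complex.exp (Complex.I * ((2 * √a * (star q.1 * ∑ p, c p * h (p, i) ω).re : ℝ) : ℂ)) *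
        Complex.exp (Complex.I * ((2 * √b * (star q.2 * ∑ p, d p * h (p, i) ω).re : ℝ) : ℂ))))]
    have e : ∀ i, ∫ q : ℂ × ℂ,
        (Complex.exp (Complex.I * ((2 * √a * (star q.1 * ∑ p, c p * h (p, i) ω).re : ℝ) : ℂ)) *
        Complex.exp (Complex.I * ((2 * √b * (star q.2 * ∑ p, d p * h (p, i) ω).re : ℝ) : ℂ)))
        ∂(complexGaussian.prod complexGaussian) =
        Complex.exp (-((a * ‖∑ p, c p * h (p, i) ω‖ ^ 2 : ℝ) : ℂ)) *
        Complex.exp (-((b * ‖∑ p, d p * h (p, i) ω‖ ^ 2 : ℝ) : ℂ)) := by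
      intro i
      rw [cexp_neg_mul_sq_norm_eq_integral ha, cexp_neg_mul_sq_norm_eq_integral hb,
        ← integral_prod_mul]
    simp_rw [e]
    rw [Finset.prod_mul_distrib, ← Complex.exp_sum, ← Complex.exp_sum, Finset.sum_neg_distrib,
      Finset.sum_neg_distrib, ← Complex.ofReal_sum, ← Complex.ofReal_sum, ← Finset.mul_sum,
      ← Finset.mul_sum, mul_comm a, mul_comm b]
    push_cast
    rfl
  -- `G` is a product of unimodular factors, so boundedness suffices for Fubini.
  have hI : Integrable (Function.uncurry G) (P.prod M) := by
    have hm' : ∀ q, AEMeasurable (fun x : Ω × (κ → ℂ × ℂ) => h q x.1) (P.prod M) := fun q =>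
      (hm q).comp_quasiMeasurePreserving Measure.quasiMeasurePreserving_fst
    refine Integrable.mono' (integrable_const (1 : ℝ)) ?_ (ae_of_all _ fun x => ?_)
    · refine AEMeasurable.aestronglyMeasurable ?_
      refine Finset.aemeasurable_fun_prod _ fun q _ => ?_
      have hw : AEMeasurable (fun x : Ω × (κ → ℂ × ℂ) => w x.2 q) (P.prod M) := by
        have hc : Continuous fun ζ => w ζ q := by
          simp only [w]
          fun_prop
        exact (hc.measurable.comp measurable_snd).aemeasurable
      exact Complex.measurable_exp.comp_aemeasurable ((Complex.measurable_ofReal.comp_aemeasurable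
        (Complex.measurable_re.comp_aemeasurable (hw.mul (hm' q)))).const_mul _)
    · simp only [Function.uncurry, G]
      rw [norm_prod]
      refine (Finset.prod_eq_one fun q _ => ?_).le
      rw [mul_comm, Complex.norm_exp_ofReal_mul_I]
  rw [← Complex.ofReal_inj, ← integral_complex_ofReal]
  simp_rw [h1]
  rw [integral_integral_swap hI]
  have h2 : ∀ ζ, ∫ ω, G ω ζ ∂P = ∏ i, Complex.exp (-((a * ‖(ζ i).1‖ ^ 2 + b * ‖(ζ i).2‖ ^ 2
        + 2 * √a * √b * (star (ζ i).1 * (ζ i).2 * ∑ p, c p * star (d p)).re : ℝ) : ℂ)) := by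
    intro ζ
    simp only [G]
    rw [integral_cexp_re_sum hind hlaw, Fintype.prod_prod_type_right]
    refine Finset.prod_congr rfl fun i _ => ?_
    rw [← Complex.exp_sum, Finset.sum_neg_distrib, ← Complex.ofReal_sum,
      ← sum_norm_sq_add c d hc hd ha hb]
  simp_rw [h2]
  rw [hM, integral_fintype_prod_eq_prod (fun (_ : κ) (q : ℂ × ℂ) =>
    Complex.exp (-((a * ‖q.1‖ ^ 2 + b * ‖q.2‖ ^ 2
        + 2 * √a * √b * (star q.1 * q.2 * ∑ p, c p * star (d p)).re : ℝ) : ℂ))),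
    integral_pair_complexGaussian ha hb hρ, Finset.prod_const, Finset.card_univ]
  push_cast
  rw [inv_pow]

end Gaussian

/-! ### Second moments -/

lemma memLp_two_complexGaussian : MemLp (fun z : ℂ => z) 2 complexGaussian := by
  rw [complexGaussian, memLp_map_measure_iff (by fun_prop) (by fun_prop)]
  have h : MemLp (fun x : ℝ => x) 2 (gaussianReal 0 (1 / 2)) := memLp_id_gaussianReal 2
  have h1 : MemLp (fun p : ℝ × ℝ => (p.1 : ℂ)) 2
      ((gaussianReal 0 (1 / 2)).prod (gaussianReal 0 (1 / 2))) := (h.comp_fst _).ofReal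
  have h2 : MemLp (fun p : ℝ × ℝ => (p.2 : ℂ)) 2
      ((gaussianReal 0 (1 / 2)).prod (gaussianReal 0 (1 / 2))) := (h.comp_snd _).ofReal
  exact h1.add (h2.mul_const _)

lemma integral_complexGaussian : ∫ z : ℂ, z ∂complexGaussian = 0 := by
  have h : Integrable (fun x : ℝ => x) (gaussianReal 0 (1 / 2)) :=
    (memLp_id_gaussianReal 1).integrable le_rfl
  rw [complexGaussian, integral_map (by fun_prop) (by fun_prop)]
  have h1 : Integrable (fun p : ℝ × ℝ => (p.1 : ℂ))
      ((gaussianReal 0 (1 / 2)).prod (gaussianReal 0 (1 / 2))) := (h.comp_fst _).ofReal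
  have h2 : Integrable (fun p : ℝ × ℝ => (p.2 : ℂ))
      ((gaussianReal 0 (1 / 2)).prod (gaussianReal 0 (1 / 2))) := (h.comp_snd _).ofReal
  rw [integral_add h1 (h2.mul_const _), integral_mul_const, integral_complex_ofReal,
    integral_complex_ofReal, integral_fun_fst (fun x : ℝ => x), integral_fun_snd (fun x : ℝ => x),
    integral_id_gaussianReal]
  simp

lemma integral_sq_gaussianReal (v : NNReal) : ∫ x : ℝ, x ^ 2 ∂(gaussianReal 0 v) = v := by
  have h := variance_fun_id_gaussianReal (μ := 0) (v := v)
  rwa [variance_of_integral_eq_zero (by fun_prop) integral_id_gaussianReal] at h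

lemma integral_mul_star_complexGaussian : ∫ z : ℂ, z * star z ∂complexGaussian = 1 := by
  have h : Integrable (fun x : ℝ => x ^ 2) (gaussianReal 0 (1 / 2)) :=
    MemLp.integrable_sq (memLp_id_gaussianReal 2)
  have e : ∀ z : ℂ, z * star z = ((‖z‖ ^ 2 : ℝ) : ℂ) := fun z => by
    rw [Complex.star_def, Complex.mul_conj, Complex.sq_norm]
  simp_rw [e]
  rw [integral_complex_ofReal, complexGaussian, integral_map (by fun_prop)
    (Continuous.aestronglyMeasurable (by fun_prop))]
  simp_rw [Complex.sq_norm, Complex.normSq_add_mul_I]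
  rw [integral_add (h.comp_fst _) (h.comp_snd _), integral_fun_fst (fun x : ℝ => x ^ 2),
    integral_fun_snd (fun x : ℝ => x ^ 2), integral_sq_gaussianReal]
  simp
  norm_num

section Moments

variable {Ω : Type*} [MeasurableSpace Ω] {P : Measure Ω} {ι κ : Type*}
  {h : ι × κ → Ω → ℂ}

lemma memLp_two_of_hasLaw {Z : Ω → ℂ} (hZ : HasLaw Z complexGaussian P) : MemLp Z 2 P := by
  have h := memLp_two_complexGaussian
  rwa [← hZ.map_eq, memLp_map_measure_iff (by fun_prop) hZ.aemeasurable] at h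

lemma memLp_two_sum_mul [Fintype ι] (hlaw : ∀ q, HasLaw (h q) complexGaussian P) (c : ι → ℂ) (i : κ) :
    MemLp (fun ω => ∑ p, c p * h (p, i) ω) 2 P :=
  memLp_finsetSum _ fun p _ => (memLp_two_of_hasLaw (hlaw (p, i))).const_mul (c p)

lemma integral_mul_star_of_iIndepFun [DecidableEq ι] [DecidableEq κ] (hind : iIndepFun h P)
    (hlaw : ∀ q, HasLaw (h q) complexGaussian P) (q q' : ι × κ) :
    ∫ ω, h q ω * star (h q' ω) ∂P = if q = q' then 1 else 0 := by
  split_ifs with e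
  · subst e
    rw [← integral_mul_star_complexGaussian, ← (hlaw q).map_eq,
      integral_map (hlaw q).aemeasurable (Continuous.aestronglyMeasurable (by fun_prop))]
  · have hi : IndepFun (h q) (fun ω => star (h q' ω)) P :=
      (hind.indepFun e).comp measurable_id continuous_star.measurable
    have hm := (hlaw q').aemeasurable
    rw [hi.integral_fun_mul_eq_mul_integral (hlaw q).aemeasurable.aestronglyMeasurable
      (continuous_star.measurable.comp_aemeasurable hm).aestronglyMeasurable,
      ← integral_map (f := fun z : ℂ => z) (hlaw q).aemeasurable (by fun_prop), (hlaw q).map_eq,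
      integral_complexGaussian, zero_mul]

lemma integrable_mul_star_sum [Fintype ι] (hlaw : ∀ q, HasLaw (h q) complexGaussian P) (c d : ι → ℂ)
    (i i' : κ) :
    Integrable (fun ω => (∑ p, c p * h (p, i) ω) * star (∑ p, d p * h (p, i') ω)) P :=
  (memLp_two_sum_mul hlaw c i).integrable_mul (memLp_two_sum_mul hlaw d i').star

lemma integral_mul_star_sum [Fintype ι] [DecidableEq κ] (hind : iIndepFun h P)
    (hlaw : ∀ q, HasLaw (h q) complexGaussian P) (c d : ι → ℂ) (i i' : κ) :
    ∫ ω, (∑ p, c p * h (p, i) ω) * star (∑ p, d p * h (p, i') ω) ∂P =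
      if i = i' then ∑ p, c p * star (d p) else 0 := by
  classical
  have e : ∀ ω, (∑ p, c p * h (p, i) ω) * star (∑ p, d p * h (p, i') ω) =
      ∑ p, ∑ p', (c p * star (d p')) * (h (p, i) ω * star (h (p', i') ω)) := by
    intro ω
    rw [star_sum, Finset.sum_mul_sum]
    refine Finset.sum_congr rfl fun p _ => Finset.sum_congr rfl fun p' _ => ?_
    rw [star_mul']
    ring
  have hI : ∀ p p', Integrable
      (fun ω => (c p * star (d p')) * (h (p, i) ω * star (h (p', i') ω))) P := fun p p' =>
    ((memLp_two_of_hasLaw (hlaw (p, i))).integrable_mul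
      (memLp_two_of_hasLaw (hlaw (p', i'))).star).const_mul _
  simp_rw [e]
  rw [integral_finsetSum _ fun p _ => integrable_finsetSum _ fun p' _ => hI p p']
  simp_rw [integral_finsetSum _ fun p' _ => hI _ p', integral_const_mul,
    integral_mul_star_of_iIndepFun hind hlaw]
  split_ifs with hi
  · subst hi; simp
  · simp [hi]

lemma integrable_sum_norm_sq [Fintype κ] [Fintype ι] (hlaw : ∀ q, HasLaw (h q) complexGaussian P)
    (c : ι → ℂ) : Integrable (fun ω => ∑ i, ‖∑ p, c p * h (p, i) ω‖ ^ 2) P :=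
  integrable_finsetSum _ fun i _ => (memLp_two_sum_mul hlaw c i).integrable_norm_pow (by norm_num)

end Moments

/-! ### The high-SNR limit of the covariances -/

/-- For `ε ≤ 1` this yields the dominating function `|log X| + 1`, independent of `ε`. -/
lemma abs_log_add_le {x ε : ℝ} (hx : 0 < x) (hε : 0 ≤ ε) :
    |Real.log (x + ε)| ≤ |Real.log x| + ε := by
  have h1 : Real.log x ≤ Real.log (x + ε) := Real.log_le_log hx (by linarith)
  have h2 : Real.log (1 + ε) ≤ ε := by
    have := Real.log_le_sub_one_of_pos (show 0 < 1 + ε by linarith); linarith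
  rw [abs_le]
  constructor
  · linarith [neg_abs_le (Real.log x)]
  · rcases le_total 1 x with h | h
    · have : Real.log (x + ε) ≤ Real.log (x * (1 + ε)) :=
        Real.log_le_log (by linarith) (by nlinarith)
      rw [Real.log_mul hx.ne' (by linarith)] at this
      linarith [le_abs_self (Real.log x)]
    · have : Real.log (x + ε) ≤ Real.log (1 + ε) := Real.log_le_log (by linarith) (by linarith)
      linarith [abs_nonneg (Real.log x)]

section Limit

variable {Ω : Type*} [MeasurableSpace Ω] {P : Measure Ω} [IsProbabilityMeasure P] {X Y : Ω → ℝ}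

lemma memLp_log_add (hXm : AEMeasurable X P) (hX : MemLp (fun ω => Real.log (X ω)) 2 P)
    (hpos : ∀ᵐ ω ∂P, 0 < X ω) {ε : ℝ} (hε : 0 ≤ ε) :
    MemLp (fun ω => Real.log (X ω + ε)) 2 P := by
  refine (hX.norm.add (memLp_const ε)).mono'
    (Real.measurable_log.comp_aemeasurable (hXm.add_const ε)).aestronglyMeasurable ?_
  filter_upwards [hpos] with ω h using abs_log_add_le h hε

lemma tendsto_log_add {x : ℝ} (hx : 0 < x) :
    Tendsto (fun ε : ℝ => Real.log (x + ε)) (𝓝[>] 0) (𝓝 (Real.log x)) := by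
  have h : ContinuousAt (fun ε : ℝ => Real.log (x + ε)) 0 :=
    ContinuousAt.log (by fun_prop) (by simpa using hx.ne')
  simpa using h.tendsto.mono_left nhdsWithin_le_nhds

lemma tendsto_integral_log_add (hXm : AEMeasurable X P)
    (hX : MemLp (fun ω => Real.log (X ω)) 2 P) (hpos : ∀ᵐ ω ∂P, 0 < X ω) :
    Tendsto (fun ε : ℝ => ∫ ω, Real.log (X ω + ε) ∂P) (𝓝[>] 0)
      (𝓝 (∫ ω, Real.log (X ω) ∂P)) := by
  refine tendsto_integral_filter_of_dominated_convergence (fun ω => |Real.log (X ω)| + 1)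
    (Eventually.of_forall fun ε =>
      (Real.measurable_log.comp_aemeasurable (hXm.add_const ε)).aestronglyMeasurable) ?_
    ((hX.integrable (by norm_num)).abs.add (integrable_const 1)) ?_
  · filter_upwards [Ioc_mem_nhdsGT (zero_lt_one' ℝ)] with ε hε
    filter_upwards [hpos] with ω h
    exact (abs_log_add_le h hε.1.le).trans (by linarith [hε.2])
  · filter_upwards [hpos] with ω h using tendsto_log_add h

lemma tendsto_covariance_log_add (hXm : AEMeasurable X P) (hYm : AEMeasurable Y P)
    (hX : MemLp (fun ω => Real.log (X ω)) 2 P) (hY : MemLp (fun ω => Real.log (Y ω)) 2 P)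
    (hXpos : ∀ᵐ ω ∂P, 0 < X ω) (hYpos : ∀ᵐ ω ∂P, 0 < Y ω) :
    Tendsto (fun ε : ℝ => cov[fun ω => Real.log (X ω + ε), fun ω => Real.log (Y ω + ε); P])
      (𝓝[>] 0) (𝓝 (cov[fun ω => Real.log (X ω), fun ω => Real.log (Y ω); P])) := by
  have h1 : Tendsto (fun ε : ℝ => ∫ ω, Real.log (X ω + ε) * Real.log (Y ω + ε) ∂P) (𝓝[>] 0)
      (𝓝 (∫ ω, Real.log (X ω) * Real.log (Y ω) ∂P)) := by
    refine tendsto_integral_filter_of_dominated_convergence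
      (fun ω => (|Real.log (X ω)| + 1) * (|Real.log (Y ω)| + 1))
      (Eventually.of_forall fun ε =>
        ((Real.measurable_log.comp_aemeasurable (hXm.add_const ε)).mul
          (Real.measurable_log.comp_aemeasurable (hYm.add_const ε))).aestronglyMeasurable) ?_
      ((hX.norm.add (memLp_const 1)).integrable_mul (hY.norm.add (memLp_const 1))) ?_
    · filter_upwards [Ioc_mem_nhdsGT (zero_lt_one' ℝ)] with ε hε
      filter_upwards [hXpos, hYpos] with ω h h'
      rw [norm_mul]
      exact mul_le_mul ((abs_log_add_le h hε.1.le).trans (by linarith [hε.2]))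
        ((abs_log_add_le h' hε.1.le).trans (by linarith [hε.2])) (norm_nonneg _) (by positivity)
    · filter_upwards [hXpos, hYpos] with ω h h' using (tendsto_log_add h).mul (tendsto_log_add h')
  rw [covariance_eq_sub hX hY]
  refine (h1.sub ((tendsto_integral_log_add hXm hX hXpos).mul
    (tendsto_integral_log_add hYm hY hYpos))).congr' ?_
  filter_upwards [self_mem_nhdsWithin] with ε hε
  have hε : 0 < ε := hε
  rw [covariance_eq_sub (memLp_log_add hXm hX hXpos hε.le) (memLp_log_add hYm hY hYpos hε.le)]
  rfl

/-- Isolates the SNR in an additive constant, invisible to the variance, and a shift `c⁻¹` that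
vanishes at high SNR. -/
lemma logb_two_one_add_mul {x c : ℝ} (hx : 0 < x) (hc : 0 < c) :
    Real.logb 2 (1 + c * x) = Real.logb 2 (Real.exp 1) * (Real.log (x + c⁻¹) + Real.log c) := by
  have h : 1 + c * x = (x + c⁻¹) * c := by field_simp; ring
  rw [h, Real.logb, Real.log_mul (by positivity) hc.ne', Real.logb, Real.log_exp]
  ring

lemma memLp_logb_one_add_mul (hXm : AEMeasurable X P) (hX : MemLp (fun ω => Real.log (X ω)) 2 P)
    (hpos : ∀ᵐ ω ∂P, 0 < X ω) {c : ℝ} (hc : 0 < c) :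
    MemLp (fun ω => Real.logb 2 (1 + c * X ω)) 2 P := by
  refine (((memLp_log_add hXm hX hpos (inv_pos.2 hc).le).add
    (memLp_const (Real.log c))).const_mul (Real.logb 2 (Real.exp 1))).ae_eq ?_
  filter_upwards [hpos] with ω h
  exact (logb_two_one_add_mul h hc).symm

end Limit

lemma tendsto_variance_mean_logb {Ω : Type*} [MeasurableSpace Ω] {P : Measure Ω}
    [IsProbabilityMeasure P] {X : ℕ → Ω → ℝ} (hXm : ∀ k, AEMeasurable (X k) P)
    (hX : ∀ k, MemLp (fun ω => Real.log (X k ω)) 2 P) (hpos : ∀ k, ∀ᵐ ω ∂P, 0 < X k ω)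
    (N : ℕ) {t : ℝ} (ht : 0 < t) :
    Tendsto (fun γ : ℝ => Var[fun ω => (1 / (N : ℝ)) *
        ∑ k ∈ Finset.range N, Real.logb 2 (1 + γ / t * X k ω); P]) atTop
      (𝓝 (((1 / (N : ℝ)) * Real.logb 2 (Real.exp 1)) ^ 2 * ∑ k ∈ Finset.range N,
        ∑ l ∈ Finset.range N,
          cov[fun ω => Real.log (X k ω), fun ω => Real.log (X l ω); P])) := by
  have hε : Tendsto (fun γ : ℝ => (γ / t)⁻¹) atTop (𝓝[>] 0) :=
    tendsto_inv_atTop_nhdsGT_zero.comp (tendsto_id.atTop_div_const ht)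
  have h : Tendsto (fun γ : ℝ => ((1 / (N : ℝ)) * Real.logb 2 (Real.exp 1)) ^ 2 *
      ∑ k ∈ Finset.range N, ∑ l ∈ Finset.range N,
        cov[fun ω => Real.log (X k ω + (γ / t)⁻¹), fun ω => Real.log (X l ω + (γ / t)⁻¹); P])
      atTop (𝓝 (((1 / (N : ℝ)) * Real.logb 2 (Real.exp 1)) ^ 2 * ∑ k ∈ Finset.range N,
        ∑ l ∈ Finset.range N,
          cov[fun ω => Real.log (X k ω), fun ω => Real.log (X l ω); P])) :=
    (tendsto_finsetSum _ fun k _ => tendsto_finsetSum _ fun l _ =>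
      (tendsto_covariance_log_add (hXm k) (hXm l) (hX k) (hX l) (hpos k) (hpos l)).comp
        hε).const_mul _
  refine h.congr' ?_
  filter_upwards [eventually_gt_atTop 0] with γ hγ
  have hc : 0 < γ / t := div_pos hγ ht
  have hL : ∀ k, MemLp (fun ω => Real.log (X k ω + (γ / t)⁻¹)) 2 P := fun k =>
    memLp_log_add (hXm k) (hX k) (hpos k) (inv_pos.2 hc).le
  have hS : MemLp (fun ω => ∑ k ∈ Finset.range N, Real.log (X k ω + (γ / t)⁻¹)) 2 P :=
    memLp_finsetSum _ fun k _ => hL k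
  have hae : ∀ᵐ ω ∂P, ∀ k, 0 < X k ω := ae_all_iff.2 hpos
  have e : (fun ω => (1 / (N : ℝ)) * ∑ k ∈ Finset.range N, Real.logb 2 (1 + γ / t * X k ω))
      =ᵐ[P] fun ω => ((1 / (N : ℝ)) * Real.logb 2 (Real.exp 1)) *
        ((∑ k ∈ Finset.range N, Real.log (X k ω + (γ / t)⁻¹)) + N * Real.log (γ / t)) := by
    filter_upwards [hae] with ω hω
    rw [Finset.sum_congr rfl fun k _ => logb_two_one_add_mul (hω k) hc, ← Finset.mul_sum,
      Finset.sum_add_distrib, Finset.sum_const, Finset.card_range, nsmul_eq_mul, mul_assoc]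
  rw [variance_congr e, variance_const_mul, variance_add_const hS.aestronglyMeasurable,
    variance_fun_sum' fun k _ => hL k]

/-- A double sum over differences, for an even function. -/
lemma sum_range_sum_range_sub {g : ℤ → ℝ} (hg : ∀ d, g (-d) = g d) {N : ℕ} (hN : 0 < N) :
    ∑ k ∈ Finset.range N, ∑ l ∈ Finset.range N, g ((k : ℤ) - l) =
      2 * ∑ d ∈ Finset.Icc 1 (N - 1), ((N : ℝ) - d) * g d + N * g 0 := by
  obtain ⟨M, rfl⟩ := Nat.exists_eq_succ_of_ne_zero hN.ne'
  simp only [Nat.succ_eq_add_one, Nat.add_sub_cancel]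
  clear hN
  induction M with
  | zero => simp
  | succ M ih =>
    have h1 : ∀ F : ℕ → ℝ, ∑ k ∈ Finset.range (M + 1), F (M + 1 - k)
        = ∑ d ∈ Finset.Icc 1 (M + 1), F d := by
      intro F
      rw [← Finset.Ico_add_one_right_eq_Icc, Finset.sum_Ico_eq_sum_range,
        ← Finset.sum_range_reflect (fun k => F (M + 1 - k))]
      refine Finset.sum_congr (by simp) fun k hk => ?_
      have := Finset.mem_range.1 hk
      congr 1
      omega
    have h2 : ∑ k ∈ Finset.range (M + 1), g ((k : ℤ) - ((M + 1 : ℕ) : ℤ))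
        = ∑ d ∈ Finset.Icc 1 (M + 1), g d := by
      rw [← h1 fun d => g d]
      refine Finset.sum_congr rfl fun k hk => ?_
      have := Finset.mem_range.1 hk
      rw [← hg, Nat.cast_sub this.le]
      congr 1
      ring
    have h3 : ∑ l ∈ Finset.range (M + 1), g (((M + 1 : ℕ) : ℤ) - (l : ℤ))
        = ∑ d ∈ Finset.Icc 1 (M + 1), g d := by
      rw [← h2]
      refine Finset.sum_congr rfl fun l _ => ?_
      rw [← hg]
      congr 1
      ring
    -- The enlarged square adds a row, a column and the corner `g 0`; by evenness the row and the
    -- column have equal sums.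
    rw [Finset.sum_range_succ]
    simp_rw [Finset.sum_range_succ _ (M + 1)]
    rw [Finset.sum_add_distrib, ih, h2, h3, sub_self]
    have h4 : ∑ d ∈ Finset.Icc 1 (M + 1), (((M + 1 + 1 : ℕ) : ℝ) - d) * g d
        = ∑ d ∈ Finset.Icc 1 M, (((M + 1 : ℕ) : ℝ) - d) * g d
          + ∑ d ∈ Finset.Icc 1 (M + 1), g d := by
      -- The added term `d = M + 1` has weight zero, so both sums run over the same range.
      have h5 : ∑ d ∈ Finset.Icc 1 M, (((M + 1 : ℕ) : ℝ) - d) * g d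
          = ∑ d ∈ Finset.Icc 1 (M + 1), (((M + 1 : ℕ) : ℝ) - d) * g d := by
        rw [Finset.sum_Icc_succ_top (by omega), sub_self, zero_mul, add_zero]
      rw [h5, ← Finset.sum_add_distrib]
      refine Finset.sum_congr rfl fun d _ => ?_
      push_cast
      ring
    rw [h4]
    push_cast
    ring

/-! ### The OFDM channel -/

/-- The coefficient of the `p`-th tap in the channel of subcarrier `k`. -/
noncomputable def tapCoeff {L : ℕ} (N : ℕ) (σ : Fin L → ℝ) (k : ℕ) (p : Fin L) : ℂ :=
  (σ p : ℂ) * Complex.exp (-(2 * Real.pi * (k : ℂ) / (N : ℂ) * (p : ℂ)) * Complex.I)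

lemma subcarrierMatrix_apply {L Nr Nt : ℕ} (N : ℕ) (σ : Fin L → ℝ)
    (H : Fin L → Matrix (Fin Nr) (Fin Nt) ℂ) (k : ℕ) (i : Fin Nr) (j : Fin Nt) :
    subcarrierMatrix N σ H k i j = ∑ p, tapCoeff N σ k p * H p i j := by
  simp [subcarrierMatrix, Matrix.sum_apply, tapCoeff]

lemma norm_cexp_phase (x y z : ℝ) :
    ‖Complex.exp (-(2 * Real.pi * (x : ℂ) / (y : ℂ) * (z : ℂ)) * Complex.I)‖ = 1 := by
  have := Complex.norm_exp_ofReal_mul_I (-(2 * Real.pi * x / y * z))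
  push_cast at this
  exact this

lemma sum_norm_sq_tapCoeff {L : ℕ} (N : ℕ) (σ : Fin L → ℝ) (k : ℕ) :
    ∑ p, ‖tapCoeff N σ k p‖ ^ 2 = ∑ p, σ p ^ 2 := by
  refine Finset.sum_congr rfl fun p _ => ?_
  have h := norm_cexp_phase k N p
  push_cast at h
  rw [tapCoeff, norm_mul, h, mul_one, Complex.norm_real, Real.norm_eq_abs, sq_abs]

lemma sum_tapCoeff_mul_star {L : ℕ} (N : ℕ) (σ : Fin L → ℝ) (k l : ℕ) :
    ∑ p, tapCoeff N σ k p * star (tapCoeff N σ l p) = freqCorr N σ ((k : ℤ) - (l : ℤ)) := by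
  refine Finset.sum_congr rfl fun p _ => ?_
  rw [tapCoeff, tapCoeff, star_mul', Complex.star_def, Complex.conj_ofReal,
    ← Complex.exp_conj, mul_mul_mul_comm, ← sq, ← Complex.exp_add]
  congr 2
  simp only [map_mul, map_neg, map_div₀, Complex.conj_ofReal, Complex.conj_I, map_natCast,
    map_ofNat]
  push_cast
  ring

lemma norm_freqCorr_le {L : ℕ} (N : ℕ) (σ : Fin L → ℝ) (d : ℤ) :
    ‖freqCorr N σ d‖ ≤ ∑ p, σ p ^ 2 := by
  refine norm_sum_le_of_le _ fun p _ => ?_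
  have h := norm_cexp_phase d N p
  push_cast at h
  rw [norm_mul, h, mul_one, norm_pow, Complex.norm_real, Real.norm_eq_abs, sq_abs]

lemma norm_freqCorr_neg {L : ℕ} (N : ℕ) (σ : Fin L → ℝ) (d : ℤ) :
    ‖freqCorr N σ (-d)‖ = ‖freqCorr N σ d‖ := by
  have h : freqCorr N σ (-d) = star (freqCorr N σ d) := by
    rw [freqCorr, freqCorr, star_sum]
    refine Finset.sum_congr rfl fun p _ => ?_
    rw [star_mul', Complex.star_def, map_pow, Complex.conj_ofReal,
      ← Complex.exp_conj]
    congr 2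
    simp only [map_mul, map_neg, map_div₀, Complex.conj_ofReal, Complex.conj_I, map_natCast,
      map_ofNat, map_intCast]
    push_cast
    ring
  rw [h, norm_star]

lemma freqCorr_zero {L : ℕ} (N : ℕ) (σ : Fin L → ℝ) (hσ : ∑ p, σ p ^ 2 = 1) :
    freqCorr N σ 0 = 1 := by
  simp [freqCorr]
  exact_mod_cast hσ

lemma flatMI_eq {Nr Nt : ℕ} (hm : min Nr Nt = 1) (γ : ℝ) (A : Matrix (Fin Nr) (Fin Nt) ℂ) :
    flatMI γ A = Real.logb 2 (1 + γ / Nt * ∑ q : Fin Nr × Fin Nt, ‖A q.1 q.2‖ ^ 2) := by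
  have hn : ∀ z : ℂ, z * star z = ((‖z‖ ^ 2 : ℝ) : ℂ) := fun z => by
    rw [Complex.star_def, Complex.mul_conj, Complex.sq_norm]
  have h : Matrix.det (1 + ((γ / (Nt : ℝ) : ℝ) : ℂ) • (A * Aᴴ)) =
      ((1 + γ / Nt * ∑ q : Fin Nr × Fin Nt, ‖A q.1 q.2‖ ^ 2 : ℝ) : ℂ) := by
    rw [Fintype.sum_prod_type]
    rcases min_choice Nr Nt with h | h
    · obtain rfl : Nr = 1 := by omega
      rw [Matrix.det_fin_one]
      simp only [Matrix.add_apply, Matrix.one_apply_eq, Matrix.smul_apply, Matrix.mul_apply,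
        Matrix.conjTranspose_apply, hn, Fin.sum_univ_one, smul_eq_mul]
      push_cast
      rfl
    · obtain rfl : Nt = 1 := by omega
      -- With one transmit antenna, `det (1 + AB) = det (1 + BA)` reduces the determinant to a
      -- scalar.
      rw [← Matrix.mul_smul, Matrix.det_one_add_mul_comm, Matrix.det_fin_one]
      simp only [Matrix.add_apply, Matrix.one_apply_eq, Matrix.smul_apply, Matrix.mul_apply,
        Matrix.conjTranspose_apply, Fin.sum_univ_one, smul_eq_mul, mul_assoc]
      simp_rw [mul_comm (star _), hn]
      rw [← Finset.mul_sum]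
      push_cast
      rfl
  rw [flatMI, h, Complex.ofReal_re]

lemma mul_eq_max_of_min_eq_one {a b : ℕ} (h : min a b = 1) : a * b = max a b := by
  rcases le_total a b with h' | h'
  · rw [min_eq_left h'] at h; subst h; simp [h']
  · rw [min_eq_right h'] at h; subst h; simp [h']

end OFDM

/-! ### Subcarrier correlation, square integrability and the limiting variance -/

theorem mainTheorem7 {Ω : Type*} [MeasurableSpace Ω] (P : Measure Ω) [IsProbabilityMeasure P]
    (L N Nr Nt : ℕ) (hN : 0 < N) (hm : min Nr Nt = 1)
    (σ : Fin L → ℝ) (hσ : ∑ p, σ p ^ 2 = 1)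
    (H : Fin L → Ω → Matrix (Fin Nr) (Fin Nt) ℂ)
    (hlaw : ∀ p i j, HasLaw (fun ω => H p ω i j) OFDM.complexGaussian P)
    (hindep : iIndepFun
      (fun (q : Fin L × Fin Nr × Fin Nt) (ω : Ω) => H q.1 ω q.2.1 q.2.2) P) :
    (∀ k < N, ∀ l < N, ∀ i j i' j',
      Integrable (fun ω => OFDM.subcarrierMatrix N σ (fun p => H p ω) k i j *
        star (OFDM.subcarrierMatrix N σ (fun p => H p ω) l i' j')) P ∧
      ∫ ω, OFDM.subcarrierMatrix N σ (fun p => H p ω) k i j *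
        star (OFDM.subcarrierMatrix N σ (fun p => H p ω) l i' j') ∂P =
          if i = i' ∧ j = j' then OFDM.freqCorr N σ ((k : ℤ) - (l : ℤ)) else 0) ∧
    (∀ γ : ℝ, 0 < γ → MemLp (fun ω => OFDM.ofdmMI N σ γ (fun p => H p ω)) 2 P) ∧
    Tendsto (fun γ : ℝ => variance (fun ω => OFDM.ofdmMI N σ γ (fun p => H p ω)) P) atTop
      (𝓝 ((Real.logb 2 (Real.exp 1)) ^ 2 *
        (2 / (N : ℝ) ^ 2 *
            ∑ d ∈ Finset.Icc 1 (N - 1),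
              ((N : ℝ) - (d : ℝ)) *
                OFDM.phiTilde (max Nr Nt) ‖OFDM.freqCorr N σ (d : ℤ)‖
          + OFDM.trigamma (max Nr Nt : ℕ) / (N : ℝ)))) := by
  let h : Fin L × Fin Nr × Fin Nt → Ω → ℂ := fun q ω => H q.1 ω q.2.1 q.2.2
  have hh : ∀ q, HasLaw (h q) OFDM.complexGaussian P := fun q => hlaw q.1 q.2.1 q.2.2
  obtain ⟨m, hmm⟩ : ∃ m, max Nr Nt = m + 1 := ⟨max Nr Nt - 1, by omega⟩
  have hcard : Fintype.card (Fin Nr × Fin Nt) = m + 1 := by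
    simp [OFDM.mul_eq_max_of_min_eq_one hm, hmm]
  have hNt : (0 : ℝ) < Nt := by exact_mod_cast (by omega : 0 < Nt)
  set X : ℕ → Ω → ℝ := fun k ω =>
    ∑ q : Fin Nr × Fin Nt, ‖∑ p, OFDM.tapCoeff N σ k p * h (p, q) ω‖ ^ 2 with hX
  have hXint : ∀ k, Integrable (X k) P := fun k => OFDM.integrable_sum_norm_sq hh _
  have hX0 : ∀ k, ∀ᵐ ω ∂P, 0 ≤ X k ω := fun k => ae_of_all _ fun ω => by positivity
  have hc : ∀ k, ∑ p, ‖OFDM.tapCoeff N σ k p‖ ^ 2 = 1 := fun k => by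
    rw [OFDM.sum_norm_sq_tapCoeff, hσ]
  have hρ : ∀ d, ‖OFDM.freqCorr N σ d‖ ≤ 1 := fun d => by
    rw [← hσ]; exact OFDM.norm_freqCorr_le N σ d
  have hpair : ∀ k l a b, 0 ≤ a → 0 ≤ b →
      ∫ ω, Real.exp (-(X k ω * a)) * Real.exp (-(X l ω * b)) ∂P =
        (((1 + a) * (1 + b) - ‖OFDM.freqCorr N σ ((k : ℤ) - l)‖ ^ 2 * (a * b)) ^ (m + 1))⁻¹ := by
    intro k l a b ha hb
    have e := OFDM.sum_tapCoeff_mul_star N σ k l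
    rw [← e, ← hcard]
    exact OFDM.integral_exp_neg_mul_pair hindep hh _ _ (hc k) (hc l) (by rw [e]; exact hρ _) ha hb
  -- The marginal is the joint transform at `b = 0`.
  have hL : ∀ k a, 0 < a → ∫ ω, Real.exp (-(X k ω * a)) ∂P = ((1 + a) ^ (m + 1))⁻¹ := by
    intro k a ha
    have := hpair k k a 0 ha.le le_rfl
    simpa using this
  have hlog : ∀ k, MemLp (fun ω => Real.log (X k ω)) 2 P := fun k =>
    OFDM.memLp_log_of_laplace (hXint k) (hX0 k) (hL k)
  have hpos : ∀ k, ∀ᵐ ω ∂P, 0 < X k ω := fun k =>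
    OFDM.ae_pos_of_laplace (hXint k).aemeasurable (hX0 k) (hL k)
  have hMI : ∀ γ, (fun ω => OFDM.ofdmMI N σ γ (fun p => H p ω)) = fun ω => (1 / (N : ℝ)) *
      ∑ k ∈ Finset.range N, Real.logb 2 (1 + γ / Nt * X k ω) := by
    intro γ
    funext ω
    rw [OFDM.ofdmMI]
    congr 1
    refine Finset.sum_congr rfl fun k _ => ?_
    rw [OFDM.flatMI_eq hm]
    simp only [OFDM.subcarrierMatrix_apply, hX, h]
  refine ⟨fun k _ l _ i j i' j' => ?_, fun γ hγ => ?_, ?_⟩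
  · simp only [OFDM.subcarrierMatrix_apply]
    refine ⟨OFDM.integrable_mul_star_sum hh _ _ (i, j) (i', j'), ?_⟩
    have e := OFDM.integral_mul_star_sum hindep hh (OFDM.tapCoeff N σ k) (OFDM.tapCoeff N σ l)
      (i, j) (i', j')
    rw [OFDM.sum_tapCoeff_mul_star] at e
    simpa only [Prod.mk.injEq] using e
  · rw [hMI]
    exact (memLp_finsetSum _ fun k _ => OFDM.memLp_logb_one_add_mul (hXint k).aemeasurable
      (hlog k) (hpos k) (div_pos hγ hNt)).const_mul _
  · simp_rw [hMI]
    have hcov : ∀ k l, cov[fun ω => Real.log (X k ω), fun ω => Real.log (X l ω); P]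
        = OFDM.phiTilde (m + 1) ‖OFDM.freqCorr N σ ((k : ℤ) - l)‖ := by
      intro k l
      rw [OFDM.phiTilde_eq_logCov m (norm_nonneg _) (hρ _)]
      exact OFDM.covariance_log_of_laplace (hXint k).aemeasurable (hXint l).aemeasurable (hlog k)
        (hlog l) (hpos k) (hpos l) (hL k) (hL l) fun a b ha hb => hpair k l a b ha.le hb.le
    convert! OFDM.tendsto_variance_mean_logb (fun k => (hXint k).aemeasurable) hlog hpos N hNt
      using 2
    simp_rw [hcov]
    have hN' : (N : ℝ) ≠ 0 := by exact_mod_cast hN.ne'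
    rw [OFDM.sum_range_sum_range_sub
      (g := fun d => OFDM.phiTilde (m + 1) ‖OFDM.freqCorr N σ d‖)
      (fun d => by rw [OFDM.norm_freqCorr_neg]) hN, OFDM.freqCorr_zero N σ hσ, hmm, norm_one]
    -- The `N` diagonal covariances have `ρ_0 = 1`; divided by `N²` they give the term `ψ'(n) / N`.
    have h1 : OFDM.phiTilde (m + 1) 1 = OFDM.trigamma ((m + 1 : ℕ) : ℝ) := by
      simp [OFDM.phiTilde]
    rw [h1]
    field_simp
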